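/- Let $(V,\mathbf 1,\omega,Y(\cdot,z))$ be a conformal vertex algebra over $\mathbb C$: $V=\bigoplus_{n\ge 0}V_n$ with $\dim V_n<\infty$, $L_0|_{V_n}=n$, where $Y(\omega,z)=\sum_n L_nz^{-n-2}$ satisfies the Virasoro relations with some central charge $c\in\mathbb{C}$, $L_{-1}a=a_{(-2)}\mathbf 1$ for all $a \in V$, and $Y(a,z)=\sum_n a_{(n)}z^{-n-1}$ satisfies the vacuum axioms and the Borcherds identity. For $a\in V$ put $$X(a,z)=z^{-1}Y(z^{L_0}a,z)=\sum_{n\in\mathbb Z}a_nz^{-n-1},\qquad Y[a,t]=Y\bigl(e^{2\pi i tL_0}a,\,e^{2\pi i t}-1\bigr)=\sum_{n\in\mathbb Z}a_{[n]}t^{-n-1}.$$ Let $\tau\in\mathbb C$ with $\operatorname{Im}\tau>0$, $q=e^{2\pi i\tau}$, and let $f$ be a meromorphic function on $\mathbb C$ with $f(t+1)=f(t)$ which is analytic on the strip $-\operatorname{Im}\tau<\operatorname{Im}t<\operatorname{Im}\tau$ except possibly for poles at the integers. Suppose that either $f$ is regular at $t=0$, or there is a constant $\alpha\in\mathbb C$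 with $f(t+\tau)=f(t)-\alpha$ (identities between meromorphic functions). Let $f(t)=\sum_{n\ge N}f_nt^n$ be the Laurent expansion of $f$ at $0$ and put $$a_{[f]}b=\operatorname{res}_t f(t)\,Y[a,t]b=\sum_{n\ge N}f_n\,a_{[n]}b .$$ Then $f$ has Fourier expansions $F_\pm(z)=\sum_{n\in\mathbb Z}F_n^\pm z^n$, with $F_n^\pm=\int_{t_0}^{t_0+1}f(t)e^{-2\pi int}\,dt$ (along the horizontal segment) for any $t_0 \in i\mathbb{R}$ with $0<\pm\operatorname{Im}t_0<\operatorname{Im}\tau$, which converge with $F_\pm(e^{2\pi it})=f(t)$ on $|q|<|z|<1$ for $F_+$ and on $1<|z|<|q|^{-1}$ for $F_-$, $z=e^{2\pi it}$; and for all $a,b\in V$ $$2\pi i\,X(a_{[f]}b,w)=\operatorname{res}_zF_-\!\left(\tfrac zw\right)X(a,z)X(b,w)-\operatorname{res}_zF_+\!\left(\tfrac zw\right)X(b,w)X(a,z)$$ as an equality in $\operatorname{Hom}(V,V((w)))$. Here each residue is a well-defined element of $\operatorname{Hom}(V,V((w)))$: applied to $v\in V$, its coefficient of $w^{-k-1}$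 is $\sum_{n}F^-_n\,a_n b_{k-n}v$, respectively $\sum_{n}F^+_n\,b_{k-n}a_nv$, a series whose terms lie in a finite dimensional subspace of $V$ and which converges absolutely there. -/

import Mathlib

open Complex Filter Topology
open VertexOperator (ncoeff)

/-- A conformal vertex algebra (vertex operator algebra) structure on the complex vector space `V`,
with grading `V = ⨁_{n ≥ 0} V_n` into finite dimensional pieces. The field `Y a : V → V((z))` is a
`VertexOperator ℂ V`, and `ncoeff (Y a) n` is the mode `a_(n)`, i.e. the coefficient of `z^(-n-1)`. -/
structure ConformalVertexAlgebra (V : Type*) [AddCommGroup V] [Module ℂ V] where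
  /-- the homogeneous pieces `V_n` -/
  weightSpace : ℕ → Submodule ℂ V
  /-- the vacuum vector -/
  vacuum : V
  /-- the conformal vector -/
  omega : V
  /-- the central charge -/
  centralCharge : ℂ
  /-- the state-field correspondence `a ↦ Y(a,z)` -/
  Y : V →ₗ[ℂ] VertexOperator ℂ V
  isInternal : DirectSum.IsInternal weightSpace
  finiteDimensional : ∀ n, FiniteDimensional ℂ (weightSpace n)
  /-- `Y(1,z) = id` -/
  vacuum_mode : ∀ (n : ℤ) (a : V), ncoeff (Y vacuum) n a = if n = -1 then a else 0
  /-- `a_(n-1) 1 = δ_{n,0} a` for `n ≥ 0` -/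
  mode_vacuum : ∀ (a : V) (n : ℕ), ncoeff (Y a) ((n : ℤ) - 1) vacuum = if n = 0 then a else 0
  /-- the Borcherds identity, in modes (for the function `z^m w^k (z-w)^n`); by the truncation
  property of vertex operators all three sums have finite support -/
  borcherds : ∀ (a b c : V) (m n k : ℤ),
    ∑ᶠ j : ℕ, ((Ring.choose m j : ℤ) : ℂ) • ncoeff (Y (ncoeff (Y a) (n + j) b)) (m + k - j) c =
      ∑ᶠ j : ℕ, ((-1) ^ j * ((Ring.choose n j : ℤ) : ℂ)) • ncoeff (Y a) (m + n - j) (ncoeff (Y b) (k + j) c) -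
      ∑ᶠ j : ℕ, ((-1) ^ j * ((Ring.choose n j : ℤ) : ℂ) * (-1) ^ n) •
        ncoeff (Y b) (n + k - j) (ncoeff (Y a) (m + j) c)
  /-- the Virasoro relations for `L_n = ω_(n+1)` -/
  virasoro : ∀ (m n : ℤ) (v : V),
    ncoeff (Y omega) (m + 1) (ncoeff (Y omega) (n + 1) v) -
        ncoeff (Y omega) (n + 1) (ncoeff (Y omega) (m + 1) v) =
      ((m : ℂ) - n) • ncoeff (Y omega) (m + n + 1) v +
      (if m = -n then centralCharge / 12 * ((m : ℂ) ^ 3 - m) else 0) • v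
  /-- `L_{-1} a = a_(-2) 1` -/
  translation : ∀ a : V, ncoeff (Y omega) 0 a = ncoeff (Y a) (-2) vacuum
  /-- `L_0` acts on `V_n` as `n` -/
  L_zero : ∀ (n : ℕ), ∀ a ∈ weightSpace n, ncoeff (Y omega) 1 a = (n : ℂ) • a

namespace ConformalVertexAlgebra

variable {V : Type*} [AddCommGroup V] [Module ℂ V] (𝓥 : ConformalVertexAlgebra V)

/-- The isomorphism `V ≃ ⨁ V_n`. -/
noncomputable def decompose : V ≃ₗ[ℂ] DirectSum ℕ (fun n => 𝓥.weightSpace n) :=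
  (LinearEquiv.ofBijective (DirectSum.coeLinearMap 𝓥.weightSpace) 𝓥.isInternal).symm

/-- The homogeneous component of conformal weight `d` of a vector. -/
noncomputable def component (d : ℕ) (a : V) : V := (𝓥.decompose a d : V)

open Classical in
/-- The finite set of weights `d` for which `a` has a nonzero component. -/
noncomputable def weights (a : V) : Finset ℕ := (𝓥.decompose a).support

/-- The modified vertex operator `X(a,z) = z⁻¹ Y(z^{L_0} a, z) = ∑_d z^{d-1} Y(a_d, z)`: the
coefficient of `z^y` is the sum over `d` of the coefficients of `z^(y-d+1)` in `Y(a_d,z)`. -/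
noncomputable def X (a : V) : VertexOperator ℂ V :=
  VertexOperator.of_coeff
    (fun y => ∑ d ∈ 𝓥.weights a, HVertexOperator.coeff (𝓥.Y (𝓥.component d a)) (y - d + 1))
    (by
      intro x
      let A : ℕ → HahnSeries ℤ V := fun d =>
        (HahnModule.of ℂ).symm (𝓥.Y (𝓥.component d a) x)
      obtain ⟨B, hB⟩ : ∃ B : ℤ, ∀ d ∈ 𝓥.weights a, B ≤ (A d).order + d - 1 := by
        induction 𝓥.weights a using Finset.induction_on with
        | empty => exact ⟨0, by simp⟩
        | insert e s _ ih =>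
          obtain ⟨B, hB⟩ := ih
          refine ⟨min B ((A e).order + e - 1), fun d hd => ?_⟩
          rcases Finset.mem_insert.1 hd with rfl | hd
          · exact min_le_right _ _
          · exact (min_le_left _ _).trans (hB d hd)
      refine ⟨B, fun y hy => ?_⟩
      by_contra! hlt
      refine hy ?_
      simp only [LinearMap.sum_apply]
      refine Finset.sum_eq_zero fun d hd => ?_
      refine VertexOperator.coeff_eq_zero_of_lt_order _ _ _ ?_
      have := hB d hd
      change y - d + 1 < (A d).order
      omega)

/-- The Laurent series of `e^{2πit}` at `t = 0`. -/
noncomputable def expSeries : LaurentSeries ℂ :=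
  ((PowerSeries.rescale (2 * Real.pi * I) (PowerSeries.exp ℂ) : PowerSeries ℂ) : LaurentSeries ℂ)

/-- The mode `a_[m] b`, i.e. the coefficient of `t^(-m-1)` in
`Y[a,t] b = Y(e^{2πi t L_0} a, e^{2πit} - 1) b
  = ∑_d ∑_n e^{2πi d t} (e^{2πit} - 1)^(-n-1) (a_d)_(n) b`.
For fixed `m` only finitely many `n` contribute. -/
noncomputable def zhuMode (a : V) (m : ℤ) (b : V) : V :=
  ∑ d ∈ 𝓥.weights a, ∑ᶠ n : ℤ,
    HahnSeries.coeff (expSeries ^ d * (expSeries - 1) ^ (-n - 1)) (-m - 1) •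
      ncoeff (𝓥.Y (𝓥.component d a)) n b

end ConformalVertexAlgebra

/-- The `n`-th Laurent coefficient `f_n = (2πi)⁻¹ ∮_{|t| = r} f(t) t^(-n-1) dt` (`r` small) at `0` of
a function `f` meromorphic at `0`. -/
noncomputable def laurentCoeff (f : ℂ → ℂ) (n : ℤ) : ℂ :=
  limUnder (𝓝[>] (0 : ℝ)) fun r : ℝ =>
    (2 * Real.pi * I)⁻¹ * ∮ t in C(0, r), f t * t ^ (-n - 1)

/-- The Fourier coefficient `∫_{t₀}^{t₀+1} f(t) e^{-2πint} dt` of a `1`-periodic function `f`, where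
`t₀ = iy` and the path is the horizontal segment. -/
noncomputable def lineFourierCoeff (f : ℂ → ℂ) (y : ℝ) (n : ℤ) : ℂ :=
  ∫ x in (0 : ℝ)..1, f (x + y * I) * exp (-(2 * Real.pi * I * n * (x + y * I)))

namespace ConformalVertexAlgebra

variable {V : Type*} [AddCommGroup V] [Module ℂ V]

/-- `a_[f] b = res_t f(t) Y[a,t] b = ∑_n f_n a_[n] b`, a finite sum, where `∑ f_n t^n` is the Laurent
expansion of `f` at `0`. -/
noncomputable def zhuProd (𝓥 : ConformalVertexAlgebra V) (f : ℂ → ℂ) (a b : V) : V :=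
  ∑ᶠ n : ℤ, laurentCoeff f n • 𝓥.zhuMode a n b

end ConformalVertexAlgebra

/-- The series `∑ u i` in the complex vector space `V` has its terms in a finite dimensional
subspace and converges there (absolutely) to `s`. -/
def HasFinDimSum {V : Type*} [AddCommGroup V] [Module ℂ V] {ι : Type*} (u : ι → V) (s : V) :
    Prop :=
  ∃ W : Submodule ℂ V, FiniteDimensional ℂ W ∧ (∀ i, u i ∈ W) ∧ s ∈ W ∧
    ∀ φ : V →ₗ[ℂ] ℂ, HasSum (fun i => φ (u i)) (φ s)

/-- For `F(z) = ∑ F_n z^n` and a formal series `P(z,w) = ∑ P_{m,l} z^(-m-1) w^(-l-1)` of operators,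
`A(w)` is the residue `res_z F(z/w) P(z,w)`, as a series in `w` with values in `Hom(V, V((w)))`: for
every `c`, the coefficient of `w^(-k-1)` of `A(w) c`
is the convergent sum `∑_n F_n P_{n,k-n} c`. -/
def IsResidueOfProd {V : Type*} [AddCommGroup V] [Module ℂ V] (F : ℤ → ℂ)
    (P : ℤ → ℤ → Module.End ℂ V) (A : VertexOperator ℂ V) : Prop :=
  ∀ (c : V) (k : ℤ), HasFinDimSum (fun n : ℤ => F n • P n (k - n) c) (ncoeff A k c)

/-!
The function `f` is a function of `z = e^{2πit}`: for some `N`, `(z - 1)^N f = k(z)` with `k`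
holomorphic on the annulus `|q| < |z| < |q|⁻¹` (`exists_eq_comp_exp`). Suppose that `a` has weight `d`
and that `a_(j) b = 0` for `j ≥ M`. Taylor expansion at `z = 1` gives
`z^(d-1) f = ∑_{i < N + M} c_i (z - 1)^(i - N) + (z - 1)^M G(z)` with `G` holomorphic on the annulus.
Hence, up to a shift by `d - 1`, the coefficients `F_n^±` are the coefficients of the two expansions of
the powers `(z - 1)^(i - N)`, plus the Laurent coefficients `ρ` of `(z - 1)^M G`, which are the same in
both strips (`exists_fourier_decomposition`).

For a power of `z - 1`, the difference of the two residues is given by the Borcherds identity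
(`exists_hasFinDimSum_binom`): it is a mode of `Y(a_(i - N) b, w)`. The remainder `ρ` contributes the
same to both residues. Indeed, by the commutator formula `[a_(x), b_(k - x)]` is a combination of the
binomial polynomials `x.choose j`, `j < M`, and `ρ` is orthogonal to these, because multiplication by
`z - 1` is adjoint to the forward difference operator (`exists_hasSum_laurent_orthogonal`,
`exists_hasFinDimSum_of_orthogonal`). In this way all infinite sums of vectors reduce to numerical
series with coefficients in finitely many vectors, which gives the convergence in finite dimensional
subspaces.

It remains to see that `2πi a_[f] b = ∑_i c_i a_(i - N) b`. As `Y[a, t] b` is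
`e^{2πidt} Y(a, e^{2πit} - 1) b`, this is the substitution `z = e^{2πit}` in a residue. It follows from
the fact that `e^{2πit} (e^{2πit} - 1)^j` has the residue `(2πi)⁻¹` at `t = 0` for `j = -1` and `0`
for all other integers `j` (`coeff_expSeries_mul_zpow`,
`finsum_laurentCoeff_smul_zhuModeOfWeight`).
The result for general `a` and `b` is the sum over the homogeneous components
(`exists_isResidueOfProd_X`, `zhuProd_eq_sum`).
-/

/-! ### Modes and conformal weights -/

namespace ConformalVertexAlgebra

variable {V : Type*} [AddCommGroup V] [Module ℂ V] (𝓥 : ConformalVertexAlgebra V)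

theorem exists_mode_eq_zero (a b : V) : ∃ M : ℕ, ∀ j : ℤ, M ≤ j → ncoeff (𝓥.Y a) j b = 0 := by
  refine ⟨(-(HahnSeries.order ((HahnModule.of ℂ).symm (𝓥.Y a b)))).toNat, fun j hj => ?_⟩
  refine VertexOperator.ncoeff_eq_zero_of_lt_order _ _ _ ?_
  omega

/-- The commutator formula, the Borcherds identity with `n = 0`. -/
theorem commutator (a b c : V) (m k : ℤ) :
    ncoeff (𝓥.Y a) m (ncoeff (𝓥.Y b) k c) - ncoeff (𝓥.Y b) k (ncoeff (𝓥.Y a) m c) =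
      ∑ᶠ j : ℕ, ((Ring.choose m j : ℤ) : ℂ) •
        ncoeff (𝓥.Y (ncoeff (𝓥.Y a) j b)) (m + k - j) c := by
  have h := 𝓥.borcherds a b c m 0 k
  have h0 : ∀ j : ℕ, j ≠ 0 → Ring.choose (0 : ℤ) j = 0 := fun j hj =>
    Ring.choose_zero_pos _ (Nat.pos_of_ne_zero hj)
  rw [finsum_eq_single (fun j : ℕ => ((-1 : ℂ) ^ j * ((Ring.choose (0 : ℤ) j : ℤ) : ℂ)) • _) 0
      (fun j hj => by simp [h0 j hj]),
    finsum_eq_single (fun j : ℕ => ((-1 : ℂ) ^ j * ((Ring.choose (0 : ℤ) j : ℤ) : ℂ) * _) • _) 0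
      (fun j hj => by simp [h0 j hj])] at h
  simpa using h.symm

/-- The translation property `(L_{-1} a)_(m) = -m a_(m-1)`. -/
theorem mode_translation (a c : V) (m : ℤ) :
    ncoeff (𝓥.Y (ncoeff (𝓥.Y 𝓥.omega) 0 a)) m c = -(m : ℂ) • ncoeff (𝓥.Y a) (m - 1) c := by
  -- as `L_{-1} a = a_(-2) 1`, and the modes of `1` vanish except for one, at most one term is left in
  -- the two sums of the Borcherds identity for `a` and `1`
  have h := 𝓥.borcherds a 𝓥.vacuum c 0 (-2) m
  have h0 : ∀ j : ℕ, j ≠ 0 → Ring.choose (0 : ℤ) j = 0 := fun j hj =>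
    Ring.choose_zero_pos _ (Nat.pos_of_ne_zero hj)
  have h2 : ∀ j : ℕ, (-1 : ℂ) ^ j * ((Ring.choose (-2 : ℤ) j : ℤ) : ℂ) = j + 1 := by
    intro j
    rw [Ring.choose_neg, show (2 : ℤ) + j - 1 = ((j + 1 : ℕ) : ℤ) by push_cast; ring,
      Ring.choose_natCast, Nat.choose_symm_add, Nat.choose_one_right]
    rw [Units.smul_def, smul_eq_mul, Int.cast_mul, Int.cast_negOnePow_natCast, ← mul_assoc,
      ← mul_pow]
    simp
  rw [finsum_eq_single _ 0 (fun j hj => by rw [h0 j hj]; simp)] at h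
  rw [𝓥.translation]
  simp only [𝓥.vacuum_mode, h2] at h
  simp only [Ring.choose_zero_right, Int.cast_one, one_smul, Nat.cast_zero, add_zero, zero_add,
    sub_zero] at h
  rw [h]
  rcases lt_trichotomy m 0 with hm | rfl | hm
  · rw [finsum_eq_single _ (-1 - m).toNat (fun j hj => by
        rw [if_neg (by omega), map_zero, smul_zero]),
      finsum_eq_zero_of_forall_eq_zero (fun j => by rw [if_neg (by omega), smul_zero])]
    have e : (((-1 - m).toNat : ℕ) : ℤ) = -1 - m := by omega
    have e' : (((-1 - m).toNat : ℕ) : ℂ) = -1 - m := by exact_mod_cast congrArg (Int.cast (R := ℂ)) e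
    rw [if_pos (by omega), e', e, sub_zero]
    rw [show (-2 : ℤ) - (-1 - m) = m - 1 by ring, show (-1 : ℂ) - m + 1 = -m by ring]
  · rw [finsum_eq_zero_of_forall_eq_zero (fun j => by
        rw [if_neg (by omega), map_zero, smul_zero]),
      finsum_eq_zero_of_forall_eq_zero (fun j => by rw [if_neg (by omega), smul_zero])]
    simp
  · rw [finsum_eq_zero_of_forall_eq_zero (fun j => by
        rw [if_neg (by omega), map_zero, smul_zero]),
      finsum_eq_single _ (m - 1).toNat (fun j hj => by
        rw [if_neg (by omega), smul_zero])]
    have e : (((m - 1).toNat : ℕ) : ℤ) = m - 1 := by omega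
    have e' : (((m - 1).toNat : ℕ) : ℂ) = m - 1 := by exact_mod_cast congrArg (Int.cast (R := ℂ)) e
    rw [if_pos (by omega), e', e, zero_sub, ← neg_smul]
    congr 1
    simp

/-- The vector `c` is an eigenvector of `L₀` with integral eigenvalue `w` (or zero). -/
def HasWeight (w : ℤ) (c : V) : Prop := ncoeff (𝓥.Y 𝓥.omega) 1 c = (w : ℂ) • c

variable {𝓥}

/-- The commutator of `L₀` with `a_(m)` is `(w - m - 1) a_(m)`: the commutator formula leaves the terms
`(L_{-1} a)_(m+1)` and `(L₀ a)_(m)`. -/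
theorem HasWeight.mode {w r : ℤ} {a c : V} (ha : 𝓥.HasWeight w a) (hc : 𝓥.HasWeight r c) (m : ℤ) :
    𝓥.HasWeight (w + r - m - 1) (ncoeff (𝓥.Y a) m c) := by
  have h := 𝓥.commutator 𝓥.omega a c 1 m
  rw [finsum_eq_finsetSum_of_support_subset (s := {0, 1}) _ (fun j hj => by
    by_contra h2
    simp only [Finset.coe_insert, Finset.coe_singleton, Set.mem_insert_iff,
      Set.mem_singleton_iff, not_or] at h2
    refine hj ?_
    have : Ring.choose (1 : ℤ) j = 0 := by
      have := Ring.choose_natCast (R := ℤ) 1 j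
      rw [Nat.cast_one] at this
      rw [this, Nat.choose_eq_zero_of_lt (by omega)]; rfl
    simp [this]), Finset.sum_pair (by simp)] at h
  simp only [Ring.choose_zero_right, Ring.choose_one_right, Nat.cast_zero, Nat.cast_one,
    Int.cast_one, one_smul] at h
  unfold HasWeight at *
  rw [mode_translation, ha, hc] at h
  simp only [map_smul, LinearMap.smul_apply, Pi.smul_apply] at h
  rw [sub_eq_iff_eq_add] at h
  rw [h, show (1 : ℤ) + m - 0 - 1 = m by ring, show (1 : ℤ) + m - 1 = m by ring, ← add_smul,
    ← add_smul]
  congr 1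
  push_cast
  ring

variable (𝓥)

theorem hasWeight_of_mem {d : ℕ} {a : V} (ha : a ∈ 𝓥.weightSpace d) : 𝓥.HasWeight d a := by
  simpa [HasWeight] using 𝓥.L_zero d a ha

theorem component_mem (d : ℕ) (a : V) : 𝓥.component d a ∈ 𝓥.weightSpace d :=
  (𝓥.decompose a d).2

theorem hasWeight_component (d : ℕ) (a : V) : 𝓥.HasWeight d (𝓥.component d a) :=
  𝓥.hasWeight_of_mem (𝓥.component_mem d a)

theorem sum_component (a : V) : ∑ d ∈ 𝓥.weights a, 𝓥.component d a = a := by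
  classical
  have h : DirectSum.coeLinearMap 𝓥.weightSpace (𝓥.decompose a) = a :=
    (LinearEquiv.ofBijective (DirectSum.coeLinearMap 𝓥.weightSpace) 𝓥.isInternal).apply_symm_apply a
  rw [DirectSum.coeLinearMap_eq_dfinsuppSum, DFinsupp.sum] at h
  convert h using 1
  refine Finset.sum_congr ?_ fun d _ => rfl
  rw [weights]

theorem component_eq_zero {d : ℕ} {a : V} (h : d ∉ 𝓥.weights a) : 𝓥.component d a = 0 := by
  classical
  rw [weights, DFinsupp.notMem_support_iff] at h
  rw [component, h]; rfl

/-- The projection to the homogeneous component of weight `d`, as a linear map. -/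
noncomputable def componentₗ (d : ℕ) : V →ₗ[ℂ] V :=
  (𝓥.weightSpace d).subtype ∘ₗ DirectSum.component ℂ ℕ (fun n => 𝓥.weightSpace n) d ∘ₗ
    𝓥.decompose.toLinearMap

theorem componentₗ_apply (d : ℕ) (a : V) : 𝓥.componentₗ d a = 𝓥.component d a := rfl

theorem component_of_mem {d e : ℕ} {a : V} (ha : a ∈ 𝓥.weightSpace e) :
    𝓥.component d a = if d = e then a else 0 := by
  have h : 𝓥.decompose a = DirectSum.lof ℂ ℕ (fun n => 𝓥.weightSpace n) e ⟨a, ha⟩ := by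
    rw [decompose, LinearEquiv.symm_apply_eq]
    exact (DirectSum.coeLinearMap_lof 𝓥.weightSpace e ⟨a, ha⟩).symm
  rw [component, h, DirectSum.lof_eq_of]
  split_ifs with hde
  · subst hde; simp
  · rw [DirectSum.of_eq_of_ne _ _ _ hde]; rfl

theorem component_L_zero (d : ℕ) (c : V) :
    𝓥.component d (ncoeff (𝓥.Y 𝓥.omega) 1 c) = (d : ℂ) • 𝓥.component d c := by
  conv_lhs => rw [← 𝓥.sum_component c]
  simp only [← componentₗ_apply, map_sum]
  have : ∀ e ∈ 𝓥.weights c,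
      𝓥.componentₗ d (ncoeff (𝓥.Y 𝓥.omega) 1 (𝓥.componentₗ e c)) =
        if d = e then (d : ℂ) • 𝓥.componentₗ d c else 0 := by
    intro e _
    have h := 𝓥.hasWeight_component e c
    rw [HasWeight] at h
    rw [componentₗ_apply, componentₗ_apply, h]
    simp only [← componentₗ_apply, map_smul]
    rw [componentₗ_apply, componentₗ_apply, 𝓥.component_of_mem (e := e) (𝓥.component_mem e c)]
    split_ifs with hde
    · subst hde; simp [componentₗ_apply]
    · simp
  rw [Finset.sum_congr rfl this, Finset.sum_ite_eq]
  split_ifs with hd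
  · rfl
  · rw [componentₗ_apply, 𝓥.component_eq_zero hd, smul_zero]

variable {𝓥}

theorem HasWeight.component_eq_zero {w : ℤ} {c : V} (hc : 𝓥.HasWeight w c) {d : ℕ}
    (hd : (d : ℤ) ≠ w) : 𝓥.component d c = 0 := by
  have h := 𝓥.component_L_zero d c
  rw [hc, ← componentₗ_apply, map_smul, componentₗ_apply, ← sub_eq_zero, ← sub_smul,
    smul_eq_zero] at h
  refine h.resolve_left fun h0 => hd ?_
  rw [sub_eq_zero] at h0
  exact_mod_cast h0.symm

/-- This is where the grading by natural numbers is used. -/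
theorem HasWeight.eq_zero_of_neg {w : ℤ} {c : V} (hc : 𝓥.HasWeight w c) (hw : w < 0) : c = 0 := by
  rw [← 𝓥.sum_component c]
  exact Finset.sum_eq_zero fun d _ => hc.component_eq_zero (by omega)

variable (𝓥)

/-! ### The modes of `X(a, z)` -/

theorem X_mode (a : V) (n : ℤ) :
    ncoeff (𝓥.X a) n =
      ∑ d ∈ 𝓥.weights a, ncoeff (𝓥.Y (𝓥.component d a)) (n + d - 1) := by
  rw [X, VertexOperator.ncoeff_of_coeff]
  refine Finset.sum_congr rfl fun d _ => ?_
  rw [VertexOperator.coeff_eq_ncoeff, show -(-n - 1 - (d : ℤ) + 1) - 1 = n + d - 1 by ring]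

theorem finite_support_X_mode (a : V) (n : ℤ) :
    (Function.support fun d : ℕ => ncoeff (𝓥.Y (𝓥.component d a)) (n + d - 1)).Finite := by
  refine (Finset.finite_toSet (𝓥.weights a)).subset fun d hd => ?_
  by_contra h
  refine hd ?_
  have h' : d ∉ 𝓥.weights a := h
  simp [𝓥.component_eq_zero h']

theorem X_mode_eq_finsum (a : V) (n : ℤ) :
    ncoeff (𝓥.X a) n = ∑ᶠ d : ℕ, ncoeff (𝓥.Y (𝓥.component d a)) (n + d - 1) := by
  rw [X_mode, finsum_eq_finsetSum_of_support_subset]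
  intro d hd
  by_contra h
  refine hd ?_
  simp [𝓥.component_eq_zero h]

/-- The mode `a_n` of `X(a,z)` as a linear function of `a`. -/
noncomputable def XModeₗ (n : ℤ) : V →ₗ[ℂ] Module.End ℂ V where
  toFun a := ncoeff (𝓥.X a) n
  map_add' a b := by
    simp only [X_mode_eq_finsum]
    rw [← finsum_add_distrib]
    · refine finsum_congr fun d => ?_
      simp only [← componentₗ_apply, map_add, Pi.add_apply]
    · exact 𝓥.finite_support_X_mode a n
    · exact 𝓥.finite_support_X_mode b n
  map_smul' r a := by
    simp only [X_mode_eq_finsum, RingHom.id_apply]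
    rw [smul_finsum']
    · refine finsum_congr fun d => ?_
      simp only [← componentₗ_apply, map_smul, Pi.smul_apply]
    · exact 𝓥.finite_support_X_mode a n

theorem XModeₗ_apply (n : ℤ) (a : V) : 𝓥.XModeₗ n a = ncoeff (𝓥.X a) n := rfl

variable {𝓥}

/-- For a vector of weight `w`, `X(a,z) = z^(w-1) Y(a,z)`. -/
theorem HasWeight.X_mode_eq {w : ℤ} {a : V} (ha : 𝓥.HasWeight w a) (n : ℤ) :
    ncoeff (𝓥.X a) n = ncoeff (𝓥.Y a) (n + w - 1) := by
  have h : ∀ d ∈ 𝓥.weights a, ncoeff (𝓥.Y (𝓥.component d a)) (n + d - 1) =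
      ncoeff (𝓥.Y (𝓥.component d a)) (n + w - 1) := by
    intro d _
    by_cases hd : (d : ℤ) = w
    · rw [hd]
    · simp [ha.component_eq_zero hd]
  rw [X_mode, Finset.sum_congr rfl h]
  conv_rhs => rw [← 𝓥.sum_component a]
  simp

theorem HasWeight.sum {ι : Type*} {s : Finset ι} {w : ℤ} {u : ι → V}
    (h : ∀ i ∈ s, 𝓥.HasWeight w (u i)) : 𝓥.HasWeight w (∑ i ∈ s, u i) := by
  rw [HasWeight, map_sum, Finset.smul_sum]
  exact Finset.sum_congr rfl h

/-- The mode `a_n` of `X(a,z)` lowers the weight by `n`. -/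
theorem HasWeight.X_mode {r : ℤ} {c : V} (hc : 𝓥.HasWeight r c) (a : V) (n : ℤ) :
    𝓥.HasWeight (r - n) (ncoeff (𝓥.X a) n c) := by
  rw [ConformalVertexAlgebra.X_mode, LinearMap.sum_apply]
  refine HasWeight.sum fun d _ => ?_
  have := (𝓥.hasWeight_component d a).mode hc (n + d - 1)
  rwa [show (d : ℤ) + r - (n + d - 1) - 1 = r - n by ring] at this

variable (𝓥)

/-- Products of two modes of total degree `k` annihilate `c` for all large `k`, since they lower the
weight by `k`. This is what makes the residues Laurent series in `w`. -/
theorem exists_X_mode_X_mode_eq_zero (a b c : V) : ∃ K : ℤ, ∀ k : ℤ, K ≤ k → ∀ n : ℤ,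
    ncoeff (𝓥.X a) n (ncoeff (𝓥.X b) (k - n) c) = 0 := by
  refine ⟨(𝓥.weights c).sup id + 1, fun k hk n => ?_⟩
  rw [← 𝓥.sum_component c]
  simp only [map_sum]
  refine Finset.sum_eq_zero fun r hr => ?_
  have h := ((𝓥.hasWeight_component r c).X_mode b (k - n)).X_mode a n
  refine h.eq_zero_of_neg ?_
  have : (r : ℤ) ≤ (𝓥.weights c).sup id := by
    exact_mod_cast Finset.le_sup (f := id) hr
  omega

end ConformalVertexAlgebra

/-! ### Convergent sums in finite dimensional subspaces -/

namespace HasFinDimSum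

variable {V : Type*} [AddCommGroup V] [Module ℂ V] {ι κ : Type*}

/-- Linear functionals separate points, so sums are unique. -/
theorem unique {u : ι → V} {s s' : V} (h : HasFinDimSum u s) (h' : HasFinDimSum u s') :
    s = s' := by
  obtain ⟨W, _, _, _, hW⟩ := h
  obtain ⟨W', _, _, _, hW'⟩ := h'
  rw [← sub_eq_zero, ← Module.forall_dual_apply_eq_zero_iff ℂ]
  intro φ
  rw [map_sub, sub_eq_zero]
  exact (hW φ).unique (hW' φ)

theorem add {u u' : ι → V} {s s' : V} (h : HasFinDimSum u s) (h' : HasFinDimSum u' s') :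
    HasFinDimSum (fun i => u i + u' i) (s + s') := by
  obtain ⟨W, _, hu, hs, hW⟩ := h
  obtain ⟨W', _, hu', hs', hW'⟩ := h'
  refine ⟨W ⊔ W', inferInstance, fun i => Submodule.add_mem_sup (hu i) (hu' i),
    Submodule.add_mem_sup hs hs', fun φ => ?_⟩
  simpa only [map_add] using (hW φ).add (hW' φ)

theorem const_smul {u : ι → V} {s : V} (r : ℂ) (h : HasFinDimSum u s) :
    HasFinDimSum (fun i => r • u i) (r • s) := by
  obtain ⟨W, hfd, hu, hs, hW⟩ := h
  refine ⟨W, hfd, fun i => W.smul_mem _ (hu i), W.smul_mem _ hs, fun φ => ?_⟩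
  simpa only [map_smul, smul_eq_mul] using (hW φ).mul_left r

theorem neg {u : ι → V} {s : V} (h : HasFinDimSum u s) :
    HasFinDimSum (fun i => -u i) (-s) := by
  simpa only [neg_one_smul] using h.const_smul (-1)

theorem sub {u u' : ι → V} {s s' : V} (h : HasFinDimSum u s) (h' : HasFinDimSum u' s') :
    HasFinDimSum (fun i => u i - u' i) (s - s') := by
  simpa only [sub_eq_add_neg] using h.add h'.neg

theorem zero : HasFinDimSum (fun _ : ι => (0 : V)) 0 :=
  ⟨⊥, inferInstance, fun _ => Submodule.zero_mem _, Submodule.zero_mem _, fun φ => by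
    simp⟩

theorem sum {t : Finset κ} {u : κ → ι → V} {s : κ → V} (h : ∀ i ∈ t, HasFinDimSum (u i) (s i)) :
    HasFinDimSum (fun n => ∑ i ∈ t, u i n) (∑ i ∈ t, s i) := by
  classical
  induction t using Finset.induction_on with
  | empty => simpa using zero
  | insert a t ha ih =>
    simp only [Finset.sum_insert ha]
    exact (h a (by simp)).add (ih fun i hi => h i (by simp [hi]))

theorem smul_right {c : ι → ℂ} {s : ℂ} (h : HasSum c s) (w : V) :
    HasFinDimSum (fun i => c i • w) (s • w) := by
  refine ⟨Submodule.span ℂ {w}, inferInstance, fun i => ?_, ?_, fun φ => ?_⟩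
  · exact Submodule.smul_mem _ _ (Submodule.mem_span_singleton_self w)
  · exact Submodule.smul_mem _ _ (Submodule.mem_span_singleton_self w)
  · simpa only [map_smul, smul_eq_mul] using h.mul_right (φ w)

theorem of_support_subset {u : ι → V} {t : Finset ι} (h : ∀ i ∉ t, u i = 0) :
    HasFinDimSum u (∑ i ∈ t, u i) := by
  refine ⟨Submodule.span ℂ (u '' t), FiniteDimensional.span_of_finite ℂ (t.finite_toSet.image u),
    fun i => ?_, ?_, fun φ => ?_⟩
  · by_cases hi : i ∈ t
    · exact Submodule.subset_span ⟨i, hi, rfl⟩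
    · rw [h i hi]; exact Submodule.zero_mem _
  · exact Submodule.sum_mem _ fun i hi => Submodule.subset_span ⟨i, hi, rfl⟩
  · rw [map_sum]
    exact hasSum_sum_of_ne_finset_zero fun i hi => by rw [h i hi, map_zero]

theorem of_finite_support {u : ι → V} (h : u.support.Finite) : HasFinDimSum u (∑ᶠ i, u i) := by
  rw [finsum_eq_sum u h]
  exact of_support_subset fun i hi => by simpa using hi

theorem comp_equiv {u : ι → V} {s : V} (h : HasFinDimSum u s) (e : κ ≃ ι) :
    HasFinDimSum (fun i => u (e i)) s := by
  obtain ⟨W, hfd, hu, hs, hW⟩ := h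
  exact ⟨W, hfd, fun i => hu _, hs, fun φ => (e.hasSum_iff (f := fun i => φ (u i))).2 (hW φ)⟩

theorem congr {u u' : ι → V} {s s' : V} (h : HasFinDimSum u s) (hu : ∀ i, u' i = u i) (hs : s' = s) :
    HasFinDimSum u' s' := by
  rwa [funext hu, hs]

theorem of_injective {u : ι → V} {s : V} {e : κ → ι} (he : Function.Injective e)
    (h0 : ∀ x ∉ Set.range e, u x = 0) (h : HasFinDimSum (fun i => u (e i)) s) :
    HasFinDimSum u s := by
  obtain ⟨W, hfd, hu, hs, hW⟩ := h
  refine ⟨W, hfd, fun x => ?_, hs, fun φ => ?_⟩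
  · by_cases hx : x ∈ Set.range e
    · obtain ⟨i, rfl⟩ := hx
      exact hu i
    · rw [h0 x hx]; exact W.zero_mem
  · exact (he.hasSum_iff (f := fun x => φ (u x)) fun x hx => by rw [h0 x hx, map_zero]).1 (hW φ)

end HasFinDimSum

/-- If all the sums which should be the coefficients of a residue exist, and if they vanish in low
degrees in `w`, then the residue exists as a vertex operator. -/
theorem exists_isResidueOfProd {V : Type*} [AddCommGroup V] [Module ℂ V] {F : ℤ → ℂ}
    {P : ℤ → ℤ → Module.End ℂ V}
    (h : ∀ c k, ∃ s, HasFinDimSum (fun n : ℤ => F n • P n (k - n) c) s)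
    (h0 : ∀ c, ∃ K : ℤ, ∀ k, K ≤ k → ∀ n, P n (k - n) c = 0) :
    ∃ A : VertexOperator ℂ V, IsResidueOfProd F P A := by
  choose s hs using h
  -- the sums are linear in `c` because they are unique
  let g : ℤ → Module.End ℂ V := fun k =>
    { toFun := fun c => s c k
      map_add' := fun c c' => (hs (c + c') k).unique (by
        simpa only [map_add, smul_add] using (hs c k).add (hs c' k))
      map_smul' := fun r c => (hs (r • c) k).unique (by
        simpa only [map_smul, smul_comm r, RingHom.id_apply] using (hs c k).const_smul r) }
  refine ⟨VertexOperator.of_coeff (fun y => g (-y - 1)) fun c => ?_, fun c k => ?_⟩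
  · obtain ⟨K, hK⟩ := h0 c
    refine ⟨-K, fun y hy => ?_⟩
    by_contra! hlt
    refine hy ((hs c (-y - 1)).unique ?_)
    simpa only [hK (-y - 1) (by omega), smul_zero] using HasFinDimSum.zero (V := V)
  · rw [VertexOperator.ncoeff_of_coeff, show -(-k - 1) - 1 = k by ring]
    exact hs c k

/-! ### The two expansions of `(z - 1)^j` -/

/-- The coefficient of `z^x` in the expansion of `(z - 1)^j` for `|z| < 1`. -/
noncomputable def binomAtZero (j x : ℤ) : ℂ :=
  if 0 ≤ x then (-1) ^ x.toNat * ((Ring.choose j x.toNat : ℤ) : ℂ) * (-1) ^ j else 0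

/-- The coefficient of `z^x` in the expansion of `(z - 1)^j` for `|z| > 1`. -/
noncomputable def binomAtInfty (j x : ℤ) : ℂ :=
  if x ≤ j then (-1) ^ (j - x).toNat * ((Ring.choose j (j - x).toNat : ℤ) : ℂ) else 0

theorem natCast_injective_int : Function.Injective (fun i : ℕ => (i : ℤ)) := Nat.cast_injective

theorem sub_natCast_injective (j : ℤ) : Function.Injective (fun i : ℕ => j - (i : ℤ)) :=
  fun _ _ h => by simpa using h

theorem binomAtZero_natCast (j : ℤ) (i : ℕ) :
    binomAtZero j i = (-1) ^ i * ((Ring.choose j i : ℤ) : ℂ) * (-1) ^ j := by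
  simp [binomAtZero]

theorem binomAtInfty_sub_natCast (j : ℤ) (i : ℕ) :
    binomAtInfty j (j - i) = (-1) ^ i * ((Ring.choose j i : ℤ) : ℂ) := by
  simp [binomAtInfty]

theorem binomAtZero_eq_zero {j x : ℤ} (hx : x ∉ Set.range (fun i : ℕ => (i : ℤ))) :
    binomAtZero j x = 0 := by
  rw [binomAtZero, if_neg]
  exact fun h => hx ⟨x.toNat, by simpa using h⟩

theorem binomAtInfty_eq_zero {j x : ℤ} (hx : x ∉ Set.range (fun i : ℕ => j - (i : ℤ))) :
    binomAtInfty j x = 0 := by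
  rw [binomAtInfty, if_neg]
  exact fun h => hx ⟨(j - x).toNat, by simp only []; omega⟩

/-- The binomial series for integral exponents. -/
theorem hasSum_choose_mul_pow (j : ℤ) {x : ℂ} (hx : ‖x‖ < 1) :
    HasSum (fun i : ℕ => (-1) ^ i * ((Ring.choose j i : ℤ) : ℂ) * x ^ i) ((1 - x) ^ j) := by
  obtain ⟨n, rfl | rfl⟩ := j.eq_nat_or_neg
  · have h : ∀ i : ℕ, (-1) ^ i * ((Ring.choose (n : ℤ) i : ℤ) : ℂ) * x ^ i =
        (-x) ^ i * 1 ^ (n - i) * (n.choose i : ℂ) := by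
      intro i
      rw [Ring.choose_natCast, neg_pow x]
      push_cast
      ring
    simp only [h]
    rw [zpow_natCast, show (1 : ℂ) - x = -x + 1 by ring, add_pow]
    exact hasSum_sum_of_ne_finset_zero fun i hi => by
      rw [Nat.choose_eq_zero_of_lt (by simpa using hi)]; simp
  · rcases n with _ | n
    · have h : ∀ i : ℕ, (-1) ^ i * ((Ring.choose (-((0 : ℕ) : ℤ)) i : ℤ) : ℂ) * x ^ i =
          if i = 0 then 1 else 0 := by
        intro i
        rw [Nat.cast_zero, neg_zero, Ring.choose_zero_ite]
        split_ifs with h <;> simp [h]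
      simp only [h]
      simpa using hasSum_ite_eq (0 : ℕ) (1 : ℂ)
    · have h : ∀ i : ℕ, (-1) ^ i * ((Ring.choose (-((n + 1 : ℕ) : ℤ)) i : ℤ) : ℂ) * x ^ i =
          ((i + n).choose n : ℂ) * x ^ i := by
        intro i
        rw [Ring.choose_neg, show ((n + 1 : ℕ) : ℤ) + i - 1 = ((n + i : ℕ) : ℤ) by
          push_cast; ring, Ring.choose_natCast, add_comm n i, Nat.choose_symm_add, Units.smul_def,
          smul_eq_mul, Int.cast_mul, Int.cast_negOnePow_natCast, ← mul_assoc, ← mul_pow]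
        simp
      simp only [h]
      rw [zpow_neg, zpow_natCast, ← one_div]
      exact hasSum_choose_mul_geometric_of_norm_lt_one n hx

theorem hasSum_binomAtZero (j : ℤ) {z : ℂ} (h1 : ‖z‖ < 1) :
    HasSum (fun x : ℤ => binomAtZero j x * z ^ x) ((z - 1) ^ j) := by
  refine (natCast_injective_int.hasSum_iff fun x hx => by
    rw [binomAtZero_eq_zero hx, zero_mul]).1 ?_
  have h := (hasSum_choose_mul_pow j h1).mul_right ((-1) ^ j)
  rw [← mul_zpow, show (1 - z) * -1 = z - 1 by ring] at h
  refine h.congr_fun fun i => ?_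
  simp only [Function.comp, binomAtZero_natCast, zpow_natCast]
  ring

theorem hasSum_binomAtInfty (j : ℤ) {z : ℂ} (h1 : 1 < ‖z‖) :
    HasSum (fun x : ℤ => binomAtInfty j x * z ^ x) ((z - 1) ^ j) := by
  have hz : z ≠ 0 := norm_pos_iff.1 (by linarith)
  refine ((sub_natCast_injective j).hasSum_iff fun x hx => by
    rw [binomAtInfty_eq_zero hx, zero_mul]).1 ?_
  have h := (hasSum_choose_mul_pow j (x := z⁻¹)
    (by rw [norm_inv]; exact inv_lt_one_of_one_lt₀ h1)).mul_right (z ^ j)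
  rw [← mul_zpow, show (1 - z⁻¹) * z = z - 1 by field_simp] at h
  refine h.congr_fun fun i => ?_
  simp only [Function.comp, binomAtInfty_sub_natCast]
  rw [zpow_sub₀ hz, zpow_natCast, inv_pow]
  field_simp

/-! ### Residues of products of two fields -/

namespace ConformalVertexAlgebra

variable {V : Type*} [AddCommGroup V] [Module ℂ V] (𝓥 : ConformalVertexAlgebra V)

/-- The Borcherds identity for the function `(z - 1)^j`, written as a difference of residues. -/
theorem exists_hasFinDimSum_binom (a b v : V) (k j : ℤ) : ∃ s s' : V,
    HasFinDimSum (fun x : ℤ => binomAtInfty j x • ncoeff (𝓥.Y a) x (ncoeff (𝓥.Y b) (k - x) v)) s ∧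
    HasFinDimSum (fun x : ℤ => binomAtZero j x • ncoeff (𝓥.Y b) (k - x) (ncoeff (𝓥.Y a) x v)) s' ∧
    s - s' = ncoeff (𝓥.Y (ncoeff (𝓥.Y a) j b)) (k - j) v := by
  obtain ⟨A, hA⟩ := 𝓥.exists_mode_eq_zero a v
  obtain ⟨B, hB⟩ := 𝓥.exists_mode_eq_zero b v
  have h := 𝓥.borcherds a b v 0 j (k - j)
  rw [finsum_eq_single _ 0 (fun i hi => by
    rw [Ring.choose_zero_pos ℤ (Nat.pos_of_ne_zero hi)]; simp)] at h
  simp only [Ring.choose_zero_right, Int.cast_one, one_smul, Nat.cast_zero, add_zero, zero_add,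
    sub_zero] at h
  refine ⟨_, _, HasFinDimSum.of_injective (sub_natCast_injective j)
    (fun x hx => by rw [binomAtInfty_eq_zero hx, zero_smul]) (HasFinDimSum.of_finite_support ?_),
    HasFinDimSum.of_injective natCast_injective_int
    (fun x hx => by rw [binomAtZero_eq_zero hx, zero_smul]) (HasFinDimSum.of_finite_support ?_), ?_⟩
  · refine (Finset.range (B - (k - j)).toNat).finite_toSet.subset fun i hi => ?_
    by_contra hi'
    rw [Finset.coe_range, Set.mem_Iio] at hi'
    exact hi (by simp only []; rw [hB _ (by omega), map_zero, smul_zero])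
  · refine (Finset.range A).finite_toSet.subset fun i hi => ?_
    by_contra hi'
    rw [Finset.coe_range, Set.mem_Iio] at hi'
    exact hi (by simp only []; rw [hA _ (by omega), map_zero, smul_zero])
  · rw [h]
    congr 1
    · refine finsum_congr fun i => ?_
      rw [binomAtInfty_sub_natCast, show k - (j - (i : ℤ)) = k - j + i by ring]
    · refine finsum_congr fun i => ?_
      rw [binomAtZero_natCast, show j + (k - j) - (i : ℤ) = k - i by ring]

/-- A sequence `ρ` which is orthogonal to the binomial polynomials `x.choose j`, `j < M`, where
`a_(j) b = 0` for `j ≥ M`, contributes equally to both residues. -/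
theorem exists_hasFinDimSum_of_orthogonal (a b v : V) (k : ℤ) {M : ℕ}
    (hM : ∀ j : ℤ, M ≤ j → ncoeff (𝓥.Y a) j b = 0) {ρ : ℤ → ℂ}
    (hρ : ∀ j < M, HasSum (fun x : ℤ => ρ x * ((Ring.choose x j : ℤ) : ℂ)) 0) : ∃ s : V,
    HasFinDimSum (fun x : ℤ => ρ x • ncoeff (𝓥.Y a) x (ncoeff (𝓥.Y b) (k - x) v)) s ∧
    HasFinDimSum (fun x : ℤ => ρ x • ncoeff (𝓥.Y b) (k - x) (ncoeff (𝓥.Y a) x v)) s := by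
  obtain ⟨A, hA⟩ := 𝓥.exists_mode_eq_zero a v
  obtain ⟨B, hB⟩ := 𝓥.exists_mode_eq_zero b v
  set G : ℤ → V := fun x => ncoeff (𝓥.Y a) x (ncoeff (𝓥.Y b) (k - x) v) with hG
  set H : ℤ → V := fun x => ncoeff (𝓥.Y b) (k - x) (ncoeff (𝓥.Y a) x v) with hH
  let w : ℕ → V := fun j => ncoeff (𝓥.Y (ncoeff (𝓥.Y a) j b)) (k - j) v
  -- the commutator is a polynomial in the mode number
  have hcomm : ∀ x, G x - H x = ∑ j ∈ Finset.range M, ((Ring.choose x j : ℤ) : ℂ) • w j := by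
    intro x
    simp only [hG, hH, 𝓥.commutator a b v x (k - x)]
    rw [finsum_eq_finsetSum_of_support_subset (s := Finset.range M)]
    · refine Finset.sum_congr rfl fun j _ => ?_
      rw [show x + (k - x) - (j : ℤ) = k - j by ring]
    · intro j hj
      by_contra hj'
      rw [Finset.coe_range, Set.mem_Iio] at hj'
      refine hj ?_
      simp [hM j (by omega)]
  -- `H x = 0` for `x ≥ A`, and `G x = 0` for `x ≤ k - B`: in the first series, the terms with `x ≥ A`
  -- are commutators, and the finitely many others are summed separately; in the second series, the
  -- terms with `x < A` are those of the first minus commutators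
  have hfin := HasFinDimSum.of_support_subset (u := fun x : ℤ => if x < A then ρ x • G x else 0)
    (t := Finset.Ico (k - B) A) (fun x hx => by
      by_cases h1 : x < A
      · rw [if_pos h1]
        rw [Finset.mem_Ico] at hx
        simp only [hG]
        rw [hB (k - x) (by omega), map_zero, smul_zero]
      · rw [if_neg h1])
  -- the numerical series `∑ ρ x * x.choose j` over `x ≥ A`, and over `x < A`; by orthogonality, their
  -- sums are opposite
  have hge := fun j (hj : j < M) =>
    ((hρ j hj).summable.indicator {x | (A : ℤ) ≤ x}).hasSum
  have hlt := fun j (hj : j < M) => (hρ j hj).sub (hge j hj)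
  have h1 := (HasFinDimSum.sum (t := Finset.range M) fun j hj =>
    HasFinDimSum.smul_right (hge j (Finset.mem_range.1 hj)) (w j)).add hfin
  have h2 := hfin.sub (HasFinDimSum.sum (t := Finset.range M) fun j hj =>
    HasFinDimSum.smul_right (hlt j (Finset.mem_range.1 hj)) (w j))
  refine ⟨_, h1.congr (fun x => ?_) rfl, h2.congr (fun x => ?_) ?_⟩
  · by_cases hx : x < A
    · simp [hx, Set.indicator, not_le.2 hx, hG]
    · have : G x = H x + ∑ j ∈ Finset.range M, ((Ring.choose x j : ℤ) : ℂ) • w j := by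
        rw [← hcomm]; abel
      have h0 : H x = 0 := by simp only [hH]; rw [hA x (by omega), map_zero]
      rw [show ncoeff (𝓥.Y a) x (ncoeff (𝓥.Y b) (k - x) v) = G x from rfl, this, h0]
      simp [hx, Set.indicator, not_lt.1 hx, Finset.smul_sum, smul_smul]
  · rw [show ncoeff (𝓥.Y b) (k - x) (ncoeff (𝓥.Y a) x v) = H x from rfl]
    by_cases hx : x < A
    · have : H x = G x - ∑ j ∈ Finset.range M, ((Ring.choose x j : ℤ) : ℂ) • w j := by
        rw [← hcomm]; abel
      rw [this]
      simp [hx, Set.indicator, not_le.2 hx, Finset.smul_sum, smul_smul, smul_sub]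
    · have h0 : H x = 0 := by simp only [hH]; rw [hA x (by omega), map_zero]
      simp [hx, Set.indicator, not_lt.1 hx, h0]
  · simp only [zero_sub, neg_smul, Finset.sum_neg_distrib, sub_neg_eq_add]
    rw [add_comm]

/-- The difference of the two residues for functions `F₊`, `F₋` which differ by the two
expansions of `∑ i, c i * (z - 1)^(i - N)` from a function that contributes equally to both. -/
theorem exists_hasFinDimSum_residues (a b v : V) (k : ℤ) {M : ℕ}
    (hM : ∀ j : ℤ, M ≤ j → ncoeff (𝓥.Y a) j b = 0) {ρ : ℤ → ℂ}
    (hρ : ∀ j < M, HasSum (fun x : ℤ => ρ x * ((Ring.choose x j : ℤ) : ℂ)) 0)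
    {Fm Fp : ℤ → ℂ} {L N : ℕ} {c : ℕ → ℂ}
    (hm : ∀ x, Fm x = ∑ i ∈ Finset.range L, c i * binomAtInfty (i - N) x + ρ x)
    (hp : ∀ x, Fp x = ∑ i ∈ Finset.range L, c i * binomAtZero (i - N) x + ρ x) : ∃ s s' : V,
    HasFinDimSum (fun x : ℤ => Fm x • ncoeff (𝓥.Y a) x (ncoeff (𝓥.Y b) (k - x) v)) s ∧
    HasFinDimSum (fun x : ℤ => Fp x • ncoeff (𝓥.Y b) (k - x) (ncoeff (𝓥.Y a) x v)) s' ∧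
    s - s' = ∑ i ∈ Finset.range L,
      c i • ncoeff (𝓥.Y (ncoeff (𝓥.Y a) (i - N) b)) (k - (i - N)) v := by
  obtain ⟨s₀, h₀, h₀'⟩ := 𝓥.exists_hasFinDimSum_of_orthogonal a b v k hM hρ
  choose s s' hs hs' hd using fun j => 𝓥.exists_hasFinDimSum_binom a b v k j
  refine ⟨_, _, ((HasFinDimSum.sum (t := Finset.range L) fun i _ =>
      (hs ((i : ℤ) - N)).const_smul (c i)).add h₀).congr (fun x => ?_) rfl,
    ((HasFinDimSum.sum (t := Finset.range L) fun i _ =>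
      (hs' ((i : ℤ) - N)).const_smul (c i)).add h₀').congr (fun x => ?_) rfl, ?_⟩
  · rw [hm, add_smul, Finset.sum_smul]
    simp only [smul_smul]
  · rw [hp, add_smul, Finset.sum_smul]
    simp only [smul_smul]
  · rw [add_sub_add_right_eq_sub, ← Finset.sum_sub_distrib]
    refine Finset.sum_congr rfl fun i _ => ?_
    rw [← smul_sub, hd]

end ConformalVertexAlgebra

/-! ### Fourier and Laurent series -/

/-- The coefficients of a Fourier series which converges on a horizontal line. Such a series converges
absolutely, hence uniformly on the line, so it can be integrated term by term. -/
theorem lineFourierCoeff_eq_of_hasSum {f : ℂ → ℂ} {y : ℝ} {c : ℤ → ℂ}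
    (h : ∀ x : ℝ, HasSum (fun n : ℤ => c n * exp (2 * Real.pi * I * (x + y * I)) ^ n)
      (f (x + y * I))) (m : ℤ) : lineFourierCoeff f y m = c m := by
  have hexp : ∀ (x : ℝ) (n : ℤ), c n * exp (2 * Real.pi * I * (x + y * I)) ^ n *
      exp (-(2 * Real.pi * I * m * (x + y * I))) =
      c n * exp (2 * Real.pi * I * ((n - m : ℤ) : ℂ) * (x + y * I)) := by
    intro x n
    rw [← exp_int_mul, mul_assoc, ← exp_add]
    congr 2
    push_cast
    ring
  have hnorm : ∀ (x : ℝ) (n : ℤ), ‖exp (2 * Real.pi * I * ((n - m : ℤ) : ℂ) * (x + y * I))‖ =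
      ‖exp (2 * Real.pi * I * ((n - m : ℤ) : ℂ) * (y * I))‖ := by
    intro x n
    rw [norm_exp, norm_exp]
    simp
  have hsum : ∀ x : ℝ, HasSum (fun n : ℤ => c n * exp (2 * Real.pi * I * ((n - m : ℤ) : ℂ) *
      (x + y * I))) (f (x + y * I) * exp (-(2 * Real.pi * I * m * (x + y * I)))) := by
    intro x
    simpa only [hexp] using (h x).mul_right (exp (-(2 * Real.pi * I * m * (x + y * I))))
  have hint := intervalIntegral.hasSum_integral_of_dominated_convergence
    (μ := MeasureTheory.volume) (a := 0) (b := 1)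
    (F := fun (n : ℤ) (x : ℝ) => c n * exp (2 * Real.pi * I * ((n - m : ℤ) : ℂ) * (x + y * I)))
    (f := fun x : ℝ => f (x + y * I) * exp (-(2 * Real.pi * I * m * (x + y * I))))
    (fun n _ => ‖c n * exp (2 * Real.pi * I * ((n - m : ℤ) : ℂ) * (y * I))‖)
    (fun n => by
      refine Continuous.aestronglyMeasurable ?_
      fun_prop)
    (fun n => Eventually.of_forall fun x _ => by rw [norm_mul, norm_mul, hnorm])
    (Eventually.of_forall fun x _ => by simpa using (hsum 0).summable.norm)
    (by simp)
    (Eventually.of_forall fun x _ => hsum x)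
  refine hint.unique ?_
  have hI : ∀ n : ℤ, (∫ x in (0 : ℝ)..1, c n *
      exp (2 * Real.pi * I * ((n - m : ℤ) : ℂ) * (x + y * I))) = if n = m then c m else 0 := by
    intro n
    split_ifs with hnm
    · subst hnm; simp
    · have hne : (2 * Real.pi * I * ((n - m : ℤ) : ℂ)) ≠ 0 := by
        refine mul_ne_zero two_pi_I_ne_zero ?_
        exact_mod_cast sub_ne_zero.2 hnm
      have : ∀ x : ℝ, c n * exp (2 * Real.pi * I * ((n - m : ℤ) : ℂ) * (x + y * I)) =
          c n * exp (2 * Real.pi * I * ((n - m : ℤ) : ℂ) * (y * I)) *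
            exp (2 * Real.pi * I * ((n - m : ℤ) : ℂ) * x) := by
        intro x
        rw [mul_assoc (c n), ← exp_add]
        congr 2
        ring
      simp only [this]
      rw [intervalIntegral.integral_const_mul, integral_exp_mul_complex hne]
      have h1 : exp (2 * Real.pi * I * ((n - m : ℤ) : ℂ)) = 1 := by
        rw [mul_comm]; exact exp_int_mul_two_pi_mul_I _
      rw [ofReal_one, mul_one, h1]
      simp
  simp only [hI]
  exact hasSum_ite_eq m (c m)

/-- Laurent expansion of a holomorphic function on an annulus. On the circle through `z` it is a Fourier
series, which converges absolutely, as the Cauchy estimates on a smaller and a larger circle show. -/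
theorem exists_hasSum_laurent {r R : ℝ} (hr : 0 ≤ r) {H : ℂ → ℂ}
    (hH : DifferentiableOn ℂ H {z | r < ‖z‖ ∧ ‖z‖ < R}) :
    ∃ c : ℤ → ℂ, ∀ z : ℂ, r < ‖z‖ → ‖z‖ < R → HasSum (fun n : ℤ => c n * z ^ n) (H z) := by
  have hopen : IsOpen {z : ℂ | r < ‖z‖ ∧ ‖z‖ < R} :=
    (isOpen_lt continuous_const continuous_norm).inter
      (isOpen_lt continuous_norm continuous_const)
  -- the coefficients as integrals over circles, which do not depend on the radius
  let C : ℝ → ℤ → ℂ := fun s n => (2 * Real.pi * I)⁻¹ • ∮ z in C(0, s), H z * z ^ (-n - 1)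
  have hdiff : ∀ n : ℤ, DifferentiableOn ℂ (fun z => H z * z ^ (-n - 1))
      {z | r < ‖z‖ ∧ ‖z‖ < R} := fun n =>
    hH.mul fun z hz => (differentiableAt_zpow.2
      (Or.inl (norm_pos_iff.1 (hr.trans_lt hz.1)))).differentiableWithinAt
  have hC' : ∀ s t : ℝ, r < s → s ≤ t → t < R → C t = C s := by
    intro s t hs hst ht
    funext n
    simp only [C]
    congr 1
    refine Complex.circleIntegral_eq_of_differentiable_on_annulus_off_countable
      (hr.trans_lt hs) hst Set.countable_empty ?_ ?_
    · refine (hdiff n).continuousOn.mono fun z hz => ?_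
      simp only [Set.mem_sdiff, Metric.mem_closedBall, Metric.mem_ball, dist_zero_right,
        not_lt] at hz
      exact ⟨hs.trans_le hz.2, hz.1.trans_lt ht⟩
    · intro z hz
      simp only [Set.mem_sdiff, Metric.mem_closedBall, Metric.mem_ball, dist_zero_right,
        not_le, Set.mem_empty_iff_false, not_false_eq_true, and_true] at hz
      exact (hdiff n).differentiableAt (hopen.mem_nhds ⟨hs.trans hz.2, hz.1.trans ht⟩)
  have hC : ∀ s t : ℝ, r < s → s < R → r < t → t < R → C t = C s := by
    intro s t hs hs' ht ht'
    rcases le_total s t with h | h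
    · exact hC' s t hs h ht'
    · exact (hC' t s ht h hs').symm
  -- Cauchy estimates
  have hbound : ∀ s : ℝ, r < s → s < R → ∃ K : ℝ, ∀ n : ℤ, ‖C s n‖ ≤ K * s ^ (-n) := by
    intro s hs hs'
    have hs0 : 0 < s := hr.trans_lt hs
    obtain ⟨K, hK⟩ := (isCompact_sphere (0 : ℂ) s).exists_bound_of_continuousOn
      (hH.continuousOn.mono fun z hz => by
        rw [mem_sphere_zero_iff_norm] at hz
        exact ⟨hz ▸ hs, hz ▸ hs'⟩)
    refine ⟨K, fun n => ?_⟩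
    refine (circleIntegral.norm_two_pi_i_inv_smul_integral_le_of_norm_le_const
      (C := K * s ^ (-n - 1)) hs0.le fun z hz => ?_).trans (le_of_eq ?_)
    · rw [norm_mul, norm_zpow]
      rw [mem_sphere_zero_iff_norm.1 hz]
      exact mul_le_mul_of_nonneg_right (hK z hz) (zpow_nonneg hs0.le _)
    · rw [zpow_sub_one₀ hs0.ne']
      field_simp
  by_cases hrR : r < R
  swap
  · exact ⟨0, fun z h1 h2 => absurd (h1.trans h2) hrR⟩
  let s₀ := (r + R) / 2
  refine ⟨C s₀, fun z hz hz' => ?_⟩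
  set s := ‖z‖ with hs
  have hs0 : 0 < s := hr.trans_lt hz
  have hs0' : (s : ℂ) ≠ 0 := by exact_mod_cast hs0.ne'
  rw [hC s s₀ hz hz' (by simp only [s₀]; linarith) (by simp only [s₀]; linarith)]
  have : Fact (0 < 2 * Real.pi) := ⟨Real.two_pi_pos⟩
  have hmem : ∀ x : AddCircle (2 * Real.pi), ‖(s : ℂ) * (AddCircle.toCircle x : ℂ)‖ = s := by
    intro x
    rw [norm_mul, Circle.norm_coe, mul_one, norm_real, Real.norm_of_nonneg hs0.le]
  let g : C(AddCircle (2 * Real.pi), ℂ) :=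
    ⟨fun x => H (s * (AddCircle.toCircle x : ℂ)), hH.continuousOn.comp_continuous
      (by fun_prop) fun x => by
        rw [Set.mem_ofPred_eq, hmem]; exact ⟨hz, hz'⟩⟩
  have hcoeff : ∀ n : ℤ, fourierCoeff g n = C s n * (s : ℂ) ^ n := by
    intro n
    rw [fourierCoeff_eq_intervalIntegral _ n 0]
    simp only [C, circleIntegral, zero_add]
    rw [← intervalIntegral.integral_smul, smul_mul_assoc, ← intervalIntegral.integral_mul_const,
      ← intervalIntegral.integral_smul]
    refine intervalIntegral.integral_congr fun θ _ => ?_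
    have hθ : circleMap 0 s θ = s * exp (θ * I) := by simp [circleMap]
    simp only [fourier_coe_apply, deriv_circleMap, smul_eq_mul, g, ContinuousMap.coe_mk,
      AddCircle.toCircle_apply_mk, Circle.coe_exp, hθ]
    have e1 : ((2 * Real.pi / (2 * Real.pi) * θ : ℝ) : ℂ) = θ := by
      rw [div_self Real.two_pi_pos.ne', one_mul]
    have e2 : exp (2 * Real.pi * I * ((-n : ℤ) : ℂ) * θ / ((2 * Real.pi : ℝ) : ℂ)) =
        exp (θ * I) ^ (-n) := by
      rw [← exp_int_mul]
      congr 1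
      have := Real.pi_ne_zero
      push_cast
      field_simp
    rw [e1, e2, zpow_sub_one₀ (mul_ne_zero hs0' (exp_ne_zero _)), mul_zpow, Complex.real_smul,
      zpow_neg (s : ℂ)]
    have := exp_ne_zero (θ * I)
    have h3 : (s : ℂ) ^ n ≠ 0 := zpow_ne_zero _ hs0'
    have := Real.pi_ne_zero
    push_cast
    field_simp
  have hsummable : Summable (fourierCoeff g) := by
    obtain ⟨s₁, h1, h1'⟩ := exists_between hz
    obtain ⟨s₂, h2, h2'⟩ := exists_between hz'
    obtain ⟨K₁, hK₁⟩ := hbound s₁ h1 (h1'.trans hz')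
    obtain ⟨K₂, hK₂⟩ := hbound s₂ (hz.trans h2) h2'
    have hs1 : 0 < s₁ := hr.trans_lt h1
    have hs2 : 0 < s₂ := hs0.trans h2
    rw [hC s s₁ hz hz' h1 (h1'.trans hz')] at hK₁
    rw [hC s s₂ hz hz' (hz.trans h2) h2'] at hK₂
    refine Summable.of_nat_of_neg ?_ ?_
    · refine Summable.of_norm_bounded (g := fun n : ℕ => K₂ * (s / s₂) ^ n)
        ((summable_geometric_of_lt_one (by positivity) ((div_lt_one hs2).2 h2)).mul_left _)
        fun n => ?_
      rw [hcoeff, norm_mul, norm_zpow, norm_real, Real.norm_of_nonneg hs0.le, zpow_natCast, div_pow]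
      refine (mul_le_mul_of_nonneg_right (hK₂ n) (by positivity)).trans (le_of_eq ?_)
      rw [zpow_neg, zpow_natCast]
      field_simp
    · refine Summable.of_norm_bounded (g := fun n : ℕ => K₁ * (s₁ / s) ^ n)
        ((summable_geometric_of_lt_one (by positivity) ((div_lt_one hs0).2 h1')).mul_left _)
        fun n => ?_
      rw [hcoeff, norm_mul, norm_zpow, norm_real, Real.norm_of_nonneg hs0.le, zpow_neg,
        zpow_natCast, div_pow]
      refine (mul_le_mul_of_nonneg_right (hK₁ (-n)) (by positivity)).trans (le_of_eq ?_)
      rw [neg_neg, zpow_natCast]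
      field_simp
  have hsum := has_pointwise_sum_fourier_series_of_summable hsummable
    ((Complex.arg z : ℝ) : AddCircle (2 * Real.pi))
  have hzs : (s : ℂ) * exp (Complex.arg z * I) = z := norm_mul_exp_arg_mul_I z
  have hval : g ((Complex.arg z : ℝ) : AddCircle (2 * Real.pi)) = H z := by
    simp only [g, ContinuousMap.coe_mk, AddCircle.toCircle_apply_mk, Circle.coe_exp]
    rw [div_self Real.two_pi_pos.ne', one_mul, hzs]
  rw [hval] at hsum
  refine hsum.congr_fun fun n => ?_
  rw [hcoeff, fourier_coe_apply, smul_eq_mul, mul_assoc]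
  congr 1
  conv_lhs => rw [← hzs]
  rw [mul_zpow, ← exp_int_mul]
  congr 2
  have := Real.pi_ne_zero
  push_cast
  field_simp

theorem abs_choose_le (n : ℤ) (j : ℕ) : |Ring.choose n j| ≤ (|n| + j) ^ j := by
  obtain ⟨m, rfl | rfl⟩ := n.eq_nat_or_neg
  · rw [Ring.choose_natCast, Nat.abs_cast, Nat.abs_cast]
    have h : (m.choose j : ℤ) ≤ (m : ℤ) ^ j := by exact_mod_cast Nat.choose_le_pow m j
    exact h.trans (pow_le_pow_left₀ (by positivity) (by omega) _)
  · rw [Ring.choose_neg, Units.smul_def, smul_eq_mul, abs_mul]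
    have h1 : |((Int.negOnePow j : ℤˣ) : ℤ)| = 1 := by
      rcases Int.units_eq_one_or (Int.negOnePow j) with h | h <;> simp [h]
    rw [h1, one_mul, abs_neg, Nat.abs_cast]
    rcases j with _ | j
    · simp
    · rw [show (m : ℤ) + (j + 1 : ℕ) - 1 = ((m + j : ℕ) : ℤ) by push_cast; ring,
        Ring.choose_natCast, Nat.abs_cast]
      have h : ((m + j).choose (j + 1) : ℤ) ≤ ((m + j : ℕ) : ℤ) ^ (j + 1) := by
        exact_mod_cast Nat.choose_le_pow (m + j) (j + 1)
      exact h.trans (pow_le_pow_left₀ (by positivity) (by push_cast; omega) _)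

/-- Binomial polynomials grow more slowly than any exponential; the right hand side is chosen such that
it is a combination of the values of `z^n` at `z = e^ε` and `z = e^(-ε)`. -/
theorem norm_choose_le_exp (n : ℤ) (j : ℕ) {ε : ℝ} (hε : 0 < ε) :
    ‖((Ring.choose n j : ℤ) : ℂ)‖ ≤
      j.factorial / ε ^ j * Real.exp (ε * j) * (Real.exp (ε * n) + Real.exp (-(ε * n))) := by
  have h1 : ‖((Ring.choose n j : ℤ) : ℂ)‖ ≤ (|(n : ℝ)| + j) ^ j := by
    rw [Complex.norm_intCast]
    exact_mod_cast abs_choose_le n j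
  have h2 : (ε * (|(n : ℝ)| + j)) ^ j / j.factorial ≤ Real.exp (ε * (|(n : ℝ)| + j)) :=
    Real.pow_div_factorial_le_exp _ (by positivity) j
  have h3 : Real.exp (ε * |(n : ℝ)|) ≤ Real.exp (ε * n) + Real.exp (-(ε * n)) := by
    rcases abs_choice (n : ℝ) with h | h <;> rw [h]
    · linarith [Real.exp_pos (-(ε * n))]
    · rw [mul_neg]; linarith [Real.exp_pos (ε * n)]
  rw [mul_pow, mul_add, Real.exp_add, div_le_iff₀ (by positivity)] at h2
  calc _ ≤ _ := h1
    _ = (ε ^ j * (|(n : ℝ)| + j) ^ j) / ε ^ j := by field_simp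
    _ ≤ (Real.exp (ε * |(n : ℝ)|) * Real.exp (ε * j) * j.factorial) / ε ^ j := by gcongr
    _ = j.factorial / ε ^ j * Real.exp (ε * j) * Real.exp (ε * |(n : ℝ)|) := by ring
    _ ≤ _ := by gcongr

/-- The coefficients of a Laurent series which converges near the unit circle decay faster than
any polynomial. -/
theorem summable_mul_choose {r R : ℝ} (hr : r < 1) (hR : 1 < R) {c : ℤ → ℂ} {H : ℂ → ℂ}
    (h : ∀ z : ℂ, r < ‖z‖ → ‖z‖ < R → HasSum (fun n : ℤ => c n * z ^ n) (H z)) (j : ℕ) :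
    Summable fun n : ℤ => c n * ((Ring.choose n j : ℤ) : ℂ) := by
  obtain ⟨ε, hε, h1, h2⟩ : ∃ ε : ℝ, 0 < ε ∧ r < Real.exp (-ε) ∧ Real.exp ε < R := by
    have c1 : ∀ᶠ ε in 𝓝[>] (0 : ℝ), r < Real.exp (-ε) :=
      (((Real.continuous_exp.comp continuous_neg).tendsto' 0 1 (by simp)).mono_left
        nhdsWithin_le_nhds).eventually (lt_mem_nhds hr)
    have c2 : ∀ᶠ ε in 𝓝[>] (0 : ℝ), Real.exp ε < R :=
      ((Real.continuous_exp.tendsto' 0 1 (by simp)).mono_left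
        nhdsWithin_le_nhds).eventually (gt_mem_nhds hR)
    obtain ⟨ε, hε⟩ := (c1.and (c2.and self_mem_nhdsWithin)).exists
    exact ⟨ε, hε.2.2, hε.1, hε.2.1⟩
  have hexp : ∀ x : ℝ, ‖exp (x : ℂ)‖ = Real.exp x := fun x => by rw [norm_exp, ofReal_re]
  have hle : Real.exp (-ε) < Real.exp ε := Real.exp_lt_exp.2 (by linarith)
  have s1 := (h (exp ((ε : ℝ) : ℂ)) (by rw [hexp]; linarith) (by rwa [hexp])).summable.norm
  have s2 := (h (exp ((-ε : ℝ) : ℂ)) (by rwa [hexp]) (by rw [hexp]; linarith)).summable.norm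
  refine Summable.of_norm_bounded ((s1.add s2).mul_left (j.factorial / ε ^ j * Real.exp (ε * j)))
    fun n => ?_
  have hpow : ∀ x : ℝ, ‖exp (x : ℂ) ^ n‖ = Real.exp (n * x) := fun x => by
    rw [← exp_int_mul, norm_exp]; simp
  rw [norm_mul, norm_mul, norm_mul, hpow, hpow]
  refine (mul_le_mul_of_nonneg_left (norm_choose_le_exp n j hε) (norm_nonneg _)).trans
    (le_of_eq ?_)
  rw [mul_neg, mul_comm (n : ℝ) ε]
  ring

theorem hasSum_shift {c : ℤ → ℂ} {z s : ℂ} (hz : z ≠ 0) (d : ℤ)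
    (h : HasSum (fun n : ℤ => c n * z ^ n) s) :
    HasSum (fun n : ℤ => c (n + d) * z ^ n) (z ^ (-d) * s) := by
  have := ((Equiv.addRight d).hasSum_iff (f := fun n : ℤ => c n * z ^ n)).2 h
  refine (this.mul_left (z ^ (-d))).congr_fun fun n => ?_
  simp only [Function.comp, Equiv.coe_addRight]
  rw [zpow_add₀ hz, zpow_neg]
  have := zpow_ne_zero d hz
  field_simp

/-- Multiplication by `(z - 1)^M` makes the coefficients orthogonal to the binomial polynomials of
degree less than `M`: by summation by parts, multiplication by `z - 1` is adjoint to the forward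
difference operator. -/
theorem exists_hasSum_laurent_orthogonal {r R : ℝ} (hr0 : 0 ≤ r) (hr : r < 1) (hR : 1 < R)
    {H : ℂ → ℂ} (hH : DifferentiableOn ℂ H {z | r < ‖z‖ ∧ ‖z‖ < R}) (M : ℕ) :
    ∃ ρ : ℤ → ℂ, (∀ z : ℂ, r < ‖z‖ → ‖z‖ < R →
      HasSum (fun n : ℤ => ρ n * z ^ n) ((z - 1) ^ M * H z)) ∧
      ∀ j < M, HasSum (fun x : ℤ => ρ x * ((Ring.choose x j : ℤ) : ℂ)) 0 := by
  induction M with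
  | zero =>
    obtain ⟨c, hc⟩ := exists_hasSum_laurent hr0 hH
    exact ⟨c, by simpa using hc, by simp⟩
  | succ M ih =>
    obtain ⟨ρ, hρ, h0⟩ := ih
    have hsum := summable_mul_choose hr hR hρ
    refine ⟨fun n => ρ (n - 1) - ρ n, fun z hz hz' => ?_, ?_⟩
    · have hz0 : z ≠ 0 := norm_pos_iff.1 (hr0.trans_lt hz)
      have := (hasSum_shift hz0 (-1) (hρ z hz hz')).sub (hρ z hz hz')
      rw [neg_neg, zpow_one] at this
      rw [show (z - 1) ^ (M + 1) * H z = z * ((z - 1) ^ M * H z) - (z - 1) ^ M * H z by ring]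
      refine this.congr_fun fun n => ?_
      rw [← sub_eq_add_neg]; ring
    -- `Δ (x.choose (j + 1)) = x.choose j` and `Δ 1 = 0` for the forward difference `Δ`
    · have hshift : ∀ {P : ℤ → ℂ} {s : ℂ}, HasSum (fun n => ρ n * P (n + 1)) s →
          HasSum (fun n => ρ (n - 1) * P n) s := by
        intro P s h
        refine (((Equiv.subRight (1 : ℤ)).hasSum_iff).2 h).congr_fun fun n => ?_
        simp
      intro j hj
      rcases j with _ | j
      · have h1 := (hsum 0).hasSum
        simp only [Ring.choose_zero_right] at h1
        have := (hshift (P := fun _ => ((1 : ℤ) : ℂ)) h1).sub h1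
        rw [sub_self] at this
        refine this.congr_fun fun n => ?_
        rw [Ring.choose_zero_right]; ring
      · have h1 := (hsum (j + 1)).hasSum
        have h2 := (h0 j (by omega)).add h1
        have h3 := (hshift (P := fun n => ((Ring.choose n (j + 1) : ℤ) : ℂ)) (h2.congr_fun
          fun n => by rw [Ring.choose_succ_succ]; push_cast; ring)).sub h1
        rw [zero_add, sub_self] at h3
        exact h3.congr_fun fun n => by ring

/-- Taylor expansion with remainder at `1` of a holomorphic function. -/
theorem exists_taylor_remainder {U : Set ℂ} (hU : U ∈ 𝓝 (1 : ℂ)) {k : ℂ → ℂ}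
    (hk : DifferentiableOn ℂ k U) (L : ℕ) : ∃ (c : ℕ → ℂ) (H : ℂ → ℂ), DifferentiableOn ℂ H U ∧
      ∀ z, k z = ∑ i ∈ Finset.range L, c i * (z - 1) ^ i + (z - 1) ^ L * H z := by
  induction L with
  | zero => exact ⟨0, k, hk, by simp⟩
  | succ L ih =>
    obtain ⟨c, H, hH, h⟩ := ih
    refine ⟨fun i => if i = L then H 1 else c i, dslope H 1,
      (differentiableOn_dslope hU).2 hH, fun z => ?_⟩
    have h1 := sub_smul_dslope H 1 z
    rw [smul_eq_mul] at h1
    have hs : ∑ i ∈ Finset.range L, (if i = L then H 1 else c i) * (z - 1) ^ i =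
        ∑ i ∈ Finset.range L, c i * (z - 1) ^ i :=
      Finset.sum_congr rfl fun i hi => by rw [if_neg (Finset.mem_range.1 hi).ne]
    simp only [Finset.sum_range_succ, hs, if_true]
    rw [h z, pow_succ, mul_assoc _ (z - 1), h1]
    ring

/-! ### Periodic functions on a strip -/

/-- Identities of meromorphic functions hold at all points of continuity. -/
theorem eq_of_eventuallyEq_codiscrete {f g : ℂ → ℂ} (h : ∀ᶠ t in codiscrete ℂ, f t = g t) {t : ℂ}
    (hf : ContinuousAt f t) (hg : ContinuousAt g t) : f t = g t := by
  have h' : ∀ᶠ s in 𝓝[≠] t, f s = g s := by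
    have := mem_codiscrete.1 h t
    rwa [disjoint_principal_right, compl_compl] at this
  exact tendsto_nhds_unique_of_eventuallyEq (hf.tendsto.mono_left nhdsWithin_le_nhds)
    (hg.tendsto.mono_left nhdsWithin_le_nhds) h'

theorem exp_two_pi_I_mul_eq_one_iff {t : ℂ} : exp (2 * Real.pi * I * t) = 1 ↔ ∃ m : ℤ, t = m := by
  rw [exp_eq_one_iff]
  refine exists_congr fun m => ?_
  rw [mul_comm (m : ℂ)]
  exact mul_right_inj' two_pi_I_ne_zero

theorem norm_exp_two_pi_I_mul (t : ℂ) :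
    ‖exp (2 * Real.pi * I * t)‖ = Real.exp (-(2 * Real.pi * t.im)) := by
  rw [norm_exp]
  congr 1
  simp

/-- A `1`-periodic function with poles only at the integers becomes, after multiplication by a power
of `e^{2πit} - 1`, a holomorphic function of `e^{2πit}`. -/
theorem exists_eq_comp_exp {h : ℝ} (hh : 0 < h) {f : ℂ → ℂ} (hf : MeromorphicAt f 0)
    (hper : ∀ᶠ t in codiscrete ℂ, f (t + 1) = f t)
    (han : ∀ t : ℂ, -h < t.im → t.im < h → (∀ m : ℤ, t ≠ m) → AnalyticAt ℂ f t) :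
    ∃ (N : ℕ) (k : ℂ → ℂ), AnalyticAt ℂ (fun t => t ^ N * f t) 0 ∧
      DifferentiableOn ℂ k
        {z | Real.exp (-(2 * Real.pi * h)) < ‖z‖ ∧ ‖z‖ < Real.exp (2 * Real.pi * h)} ∧
      ∀ t : ℂ, -h < t.im → t.im < h →
        (exp (2 * Real.pi * I * t) - 1) ^ N * f t = k (exp (2 * Real.pi * I * t)) := by
  classical
  -- the exponent `n + 1` instead of `n` makes the product vanish at the integers, whatever value `f` is
  -- given there
  obtain ⟨n, hn⟩ := hf
  have hN : AnalyticAt ℂ (fun t => t ^ (n + 1) * f t) 0 := by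
    refine (analyticAt_id.mul hn).congr (Eventually.of_forall fun t => ?_)
    simp only [Pi.mul_apply, id, sub_zero, smul_eq_mul]
    ring
  have hstrip : IsOpen {t : ℂ | -h < t.im ∧ t.im < h} :=
    (isOpen_lt continuous_const continuous_im).inter (isOpen_lt continuous_im continuous_const)
  let K₀ : ℂ → ℂ := fun t => (exp (2 * Real.pi * I * t) - 1) ^ (n + 1) * f t
  let K : ℂ → ℂ := fun t => if -h < t.im ∧ t.im < h then K₀ t else 0
  have hexp1 : ∀ t : ℂ, exp (2 * Real.pi * I * (t + 1)) = exp (2 * Real.pi * I * t) := by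
    intro t
    rw [mul_add, exp_add, mul_one, exp_two_pi_mul_I, mul_one]
  have hK : Function.Periodic K (1 : ℝ) := by
    intro t
    simp only [K, K₀, ofReal_one, add_im, one_im, add_zero, hexp1]
    split_ifs with ht
    · by_cases hm : ∃ m : ℤ, t = m
      · rw [exp_two_pi_I_mul_eq_one_iff.2 hm]; simp
      · push Not at hm
        have hm1 : ∀ m : ℤ, t + 1 ≠ m := fun m hm' => hm (m - 1) (by
          push_cast; rw [← hm']; ring)
        congr 1
        refine eq_of_eventuallyEq_codiscrete (f := fun t => f (t + 1)) hper ?_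
          (han t ht.1 ht.2 hm).continuousAt
        exact ContinuousAt.comp (f := fun t : ℂ => t + 1)
          (han (t + 1) (by simpa using ht.1) (by simpa using ht.2) hm1).continuousAt (by fun_prop)
    · rfl
  have hKK : ∀ t : ℂ, -h < t.im → t.im < h → K =ᶠ[𝓝 t] K₀ := fun t h1 h2 => by
    filter_upwards [hstrip.mem_nhds ⟨h1, h2⟩] with s hs
    exact if_pos hs
  -- near `0`, compare `e^{2πit} - 1` with `t`
  have hK0 : DifferentiableAt ℂ K 0 := by
    have hu : Differentiable ℂ (dslope (fun t => exp (2 * Real.pi * I * t)) 0) := by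
      rw [← differentiableOn_univ, differentiableOn_dslope univ_mem, differentiableOn_univ]
      fun_prop
    have h1 : ∀ t, K₀ t = dslope (fun t => exp (2 * Real.pi * I * t)) 0 t ^ (n + 1) *
        (t ^ (n + 1) * f t) := by
      intro t
      have := sub_smul_dslope (fun t => exp (2 * Real.pi * I * t)) 0 t
      simp only [sub_zero, smul_eq_mul, mul_zero, exp_zero] at this
      simp only [K₀]
      rw [← this]
      ring
    refine DifferentiableAt.congr_of_eventuallyEq ?_ (hKK 0 (by simpa using hh) (by simpa using hh))
    rw [show K₀ = _ from funext h1]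
    exact (hu.differentiableAt.pow _).mul hN.differentiableAt
  have hKd : ∀ t : ℂ, -h < t.im → t.im < h → DifferentiableAt ℂ K t := by
    intro t h1 h2
    by_cases hm : ∃ m : ℤ, t = m
    · obtain ⟨m, rfl⟩ := hm
      have h3 : K = fun t => K (t - m) := by
        funext t
        have := (hK.int_mul m) (t - m)
        simpa using this
      rw [h3]
      have h4 : DifferentiableAt ℂ K ((m : ℂ) - m) := by rwa [sub_self]
      exact DifferentiableAt.comp (f := fun t : ℂ => t - m) (m : ℂ) h4 (by fun_prop)
    · push Not at hm
      refine DifferentiableAt.congr_of_eventuallyEq ?_ (hKK t h1 h2)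
      exact DifferentiableAt.mul (by fun_prop) (han t h1 h2 hm).differentiableAt
  -- `K` descends to a function of `z`
  have hq : ∀ t : ℂ, Function.Periodic.qParam 1 t = exp (2 * Real.pi * I * t) := fun t => by
    simp [Function.Periodic.qParam]
  refine ⟨n + 1, Function.Periodic.cuspFunction 1 K, hN, ?_, ?_⟩
  · rintro z ⟨hz1, hz2⟩
    refine DifferentiableAt.differentiableWithinAt ?_
    have hz : z ≠ 0 := norm_pos_iff.1 ((Real.exp_pos _).trans hz1)
    have h1 := Function.Periodic.qParam_right_inv (one_ne_zero (α := ℝ)) hz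
    rw [← h1]
    refine Function.Periodic.differentiableAt_cuspFunction one_ne_zero hK ?_
    rw [← h1, hq, norm_exp_two_pi_I_mul, Real.exp_lt_exp] at hz1 hz2
    have := Real.two_pi_pos
    exact hKd _ (by nlinarith) (by nlinarith)
  · intro t h1 h2
    rw [← hq, Function.Periodic.eq_cuspFunction one_ne_zero hK, hq]
    exact (if_pos ⟨h1, h2⟩ : K t = K₀ t).symm

/-- The decomposition of `f` into powers of `z - 1`, times `z^(-D)`, and a remainder that vanishes to
order `M` at `z = 1`, and the resulting Fourier expansions in both strips. -/
theorem exists_fourier_decomposition {h : ℝ} (hh : 0 < h) {f k : ℂ → ℂ} {N : ℕ}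
    (hk : DifferentiableOn ℂ k
      {z | Real.exp (-(2 * Real.pi * h)) < ‖z‖ ∧ ‖z‖ < Real.exp (2 * Real.pi * h)})
    (hfk : ∀ t : ℂ, -h < t.im → t.im < h →
        (exp (2 * Real.pi * I * t) - 1) ^ N * f t = k (exp (2 * Real.pi * I * t)))
    (D : ℤ) (M : ℕ) : ∃ (c : ℕ → ℂ) (ρ : ℤ → ℂ) (G : ℂ → ℂ),
      AnalyticAt ℂ G 1 ∧
      (∀ z, z ^ D * k z = ∑ i ∈ Finset.range (N + M), c i * (z - 1) ^ i +
        (z - 1) ^ (N + M) * G z) ∧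
      (∀ j < M, HasSum (fun x : ℤ => ρ x * ((Ring.choose x j : ℤ) : ℂ)) 0) ∧
      (∀ t : ℂ, 0 < t.im → t.im < h → HasSum (fun n : ℤ =>
        (∑ i ∈ Finset.range (N + M), c i * binomAtZero (i - N) (n + D) + ρ (n + D)) *
          exp (2 * Real.pi * I * t) ^ n) (f t)) ∧
      (∀ t : ℂ, -h < t.im → t.im < 0 → HasSum (fun n : ℤ =>
        (∑ i ∈ Finset.range (N + M), c i * binomAtInfty (i - N) (n + D) + ρ (n + D)) *
          exp (2 * Real.pi * I * t) ^ n) (f t)) := by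
  have hpi := Real.two_pi_pos
  have hr : Real.exp (-(2 * Real.pi * h)) < 1 := by
    rw [Real.exp_lt_one_iff]; nlinarith
  have hR : 1 < Real.exp (2 * Real.pi * h) := by
    rw [Real.one_lt_exp_iff]; positivity
  have hopen : IsOpen {z : ℂ | Real.exp (-(2 * Real.pi * h)) < ‖z‖ ∧
      ‖z‖ < Real.exp (2 * Real.pi * h)} :=
    (isOpen_lt continuous_const continuous_norm).inter
      (isOpen_lt continuous_norm continuous_const)
  have h1 : {z : ℂ | Real.exp (-(2 * Real.pi * h)) < ‖z‖ ∧
      ‖z‖ < Real.exp (2 * Real.pi * h)} ∈ 𝓝 1 := hopen.mem_nhds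
    ⟨by rw [norm_one]; exact hr, by rw [norm_one]; exact hR⟩
  obtain ⟨c, G, hG, hc⟩ := exists_taylor_remainder h1 (k := fun z => z ^ D * k z)
    (DifferentiableOn.mul (fun z hz => (differentiableAt_zpow.2
      (Or.inl (norm_pos_iff.1 ((Real.exp_pos _).trans hz.1)))).differentiableWithinAt) hk) (N + M)
  obtain ⟨ρ, hρ, hρ0⟩ := exists_hasSum_laurent_orthogonal (Real.exp_pos _).le hr hR hG M
  -- both expansions, with `b j x` the coefficients of an expansion of `(z - 1)^j`
  have key : ∀ (b : ℤ → ℤ → ℂ) (t : ℂ), -h < t.im → t.im < h → t.im ≠ 0 →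
      (∀ j, HasSum (fun x : ℤ => b j x * exp (2 * Real.pi * I * t) ^ x)
        ((exp (2 * Real.pi * I * t) - 1) ^ j)) →
      HasSum (fun n : ℤ => (∑ i ∈ Finset.range (N + M), c i * b (i - N) (n + D) + ρ (n + D)) *
          exp (2 * Real.pi * I * t) ^ n) (f t) := by
    intro b t ht ht' ht0 hb
    have hf := hfk t ht ht'
    have hn := norm_exp_two_pi_I_mul t
    have hne : exp (2 * Real.pi * I * t) - 1 ≠ 0 := by
      rw [sub_ne_zero]
      intro h
      obtain ⟨m, rfl⟩ := exp_two_pi_I_mul_eq_one_iff.1 h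
      simp at ht0
    have hz := exp_ne_zero (2 * Real.pi * I * t)
    set z := exp (2 * Real.pi * I * t)
    have hρz := hρ z (by rw [hn, Real.exp_lt_exp]; nlinarith)
      (by rw [hn, Real.exp_lt_exp]; nlinarith)
    have hs := hasSum_shift (c := fun x => ∑ i ∈ Finset.range (N + M), c i * b (i - N) x + ρ x)
      hz D (((hasSum_sum (s := Finset.range (N + M))
        fun i _ => (hb ((i : ℤ) - N)).mul_left (c i)).add hρz).congr_fun fun n => by
        rw [add_mul, Finset.sum_mul]
        simp only [mul_assoc])
    convert hs using 1
    have e1 : ∑ i ∈ Finset.range (N + M), c i * (z - 1) ^ ((i : ℤ) - N) =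
        (∑ i ∈ Finset.range (N + M), c i * (z - 1) ^ i) * ((z - 1) ^ N)⁻¹ := by
      rw [Finset.sum_mul]
      refine Finset.sum_congr rfl fun i _ => ?_
      rw [zpow_sub₀ hne, zpow_natCast, zpow_natCast, div_eq_mul_inv, mul_assoc]
    have e2 := hc z
    rw [← hf] at e2
    rw [e1, eq_sub_of_add_eq e2.symm, pow_add, zpow_neg]
    have := zpow_ne_zero D hz
    field_simp
    ring
  refine ⟨c, ρ, G, hG.analyticAt h1, hc, hρ0, fun t ht ht' => ?_, fun t ht ht' => ?_⟩
  · refine key binomAtZero t (by linarith) ht' ht.ne' fun j => hasSum_binomAtZero j ?_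
    rw [norm_exp_two_pi_I_mul, Real.exp_lt_one_iff]
    nlinarith
  · refine key binomAtInfty t ht (by linarith) ht'.ne fun j => hasSum_binomAtInfty j ?_
    rw [norm_exp_two_pi_I_mul, Real.one_lt_exp_iff]
    nlinarith

/-! ### Taylor series and Laurent coefficients -/

/-- The function `f` is analytic at `0` with Taylor series `p`. -/
def HasTaylorSeries (f : ℂ → ℂ) (p : PowerSeries ℂ) : Prop :=
  AnalyticAt ℂ f 0 ∧ ∀ n : ℕ, iteratedDeriv n f 0 = n.factorial * PowerSeries.coeff n p

theorem AnalyticAt.exists_hasTaylorSeries {f : ℂ → ℂ} (hf : AnalyticAt ℂ f 0) :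
    ∃ p, HasTaylorSeries f p :=
  ⟨PowerSeries.mk fun n => iteratedDeriv n f 0 / n.factorial, hf, fun n => by
    rw [PowerSeries.coeff_mk, mul_div_cancel₀]
    exact_mod_cast n.factorial_ne_zero⟩

namespace HasTaylorSeries

variable {f g : ℂ → ℂ} {p q : PowerSeries ℂ}

theorem eq (hf : HasTaylorSeries f p) (hg : HasTaylorSeries g q) (h : f =ᶠ[𝓝 0] g) : p = q := by
  ext n
  have h1 := hf.2 n
  rw [h.iteratedDeriv_eq n, hg.2 n] at h1
  exact (mul_left_cancel₀ (by exact_mod_cast n.factorial_ne_zero) h1).symm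

theorem add (hf : HasTaylorSeries f p) (hg : HasTaylorSeries g q) :
    HasTaylorSeries (fun t => f t + g t) (p + q) := by
  refine ⟨hf.1.add hg.1, fun n => ?_⟩
  rw [show (fun t => f t + g t) = f + g from rfl,
    iteratedDeriv_add hf.1.contDiffAt hg.1.contDiffAt, hf.2, hg.2, map_add, mul_add]

theorem mul (hf : HasTaylorSeries f p) (hg : HasTaylorSeries g q) :
    HasTaylorSeries (fun t => f t * g t) (p * q) := by
  refine ⟨hf.1.mul hg.1, fun n => ?_⟩
  rw [show (fun t => f t * g t) = f * g from rfl,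
    iteratedDeriv_mul hf.1.contDiffAt hg.1.contDiffAt, PowerSeries.coeff_mul,
    Finset.Nat.sum_antidiagonal_eq_sum_range_succ_mk, Finset.mul_sum]
  refine Finset.sum_congr rfl fun i hi => ?_
  rw [hf.2, hg.2, Nat.cast_choose _ (Finset.mem_range_succ_iff.1 hi)]
  have h1 : (i.factorial : ℂ) ≠ 0 := by exact_mod_cast i.factorial_ne_zero
  have h2 : ((n - i).factorial : ℂ) ≠ 0 := by exact_mod_cast (n - i).factorial_ne_zero
  field_simp

theorem const (c : ℂ) : HasTaylorSeries (fun _ => c) (PowerSeries.C c) := by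
  refine ⟨analyticAt_const, fun n => ?_⟩
  rw [iteratedDeriv_const, PowerSeries.coeff_C]
  split_ifs with h
  · simp [h]
  · simp

theorem id : HasTaylorSeries (fun t => t) PowerSeries.X := by
  refine ⟨analyticAt_id, fun n => ?_⟩
  rw [iteratedDeriv_fun_id_zero, PowerSeries.coeff_X]
  split_ifs with h
  · simp [h]
  · simp

theorem pow (hf : HasTaylorSeries f p) (n : ℕ) : HasTaylorSeries (fun t => f t ^ n) (p ^ n) := by
  induction n with
  | zero => simpa using const 1
  | succ n ih => simpa only [pow_succ] using ih.mul hf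

theorem sum {s : Finset ℕ} {F : ℕ → ℂ → ℂ} {P : ℕ → PowerSeries ℂ}
    (h : ∀ i ∈ s, HasTaylorSeries (F i) (P i)) :
    HasTaylorSeries (fun t => ∑ i ∈ s, F i t) (∑ i ∈ s, P i) := by
  induction s using Finset.induction_on with
  | empty => simpa using const 0
  | insert a s ha ih =>
    simp only [Finset.sum_insert ha]
    exact (h a (by simp)).add (ih fun i hi => h i (by simp [hi]))

theorem exp_mul (c : ℂ) :
    HasTaylorSeries (fun t => exp (c * t)) (PowerSeries.rescale c (PowerSeries.exp ℂ)) := by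
  refine ⟨by fun_prop, fun n => ?_⟩
  rw [congrFun (iteratedDeriv_cexp_const_mul n c) 0, PowerSeries.coeff_rescale,
    PowerSeries.coeff_exp]
  have h1 : (n.factorial : ℂ) ≠ 0 := by exact_mod_cast n.factorial_ne_zero
  simp
  field_simp

end HasTaylorSeries

/-- The Laurent coefficients of `f` are those of the Laurent series `t^(-N) p`, if `t^N f` has the
Taylor series `p`. -/
theorem laurentCoeff_eq_coeff {f : ℂ → ℂ} {N : ℕ} {p : PowerSeries ℂ}
    (h : HasTaylorSeries (fun t => t ^ N * f t) p) (m : ℤ) :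
    laurentCoeff f m =
      (HahnSeries.single (-N : ℤ) (1 : ℂ) * (p : LaurentSeries ℂ)).coeff m := by
  rw [HahnSeries.coeff_single_mul, one_mul, sub_neg_eq_add, PowerSeries.coeff_coe]
  obtain ⟨r₀, hr₀, hball⟩ := Metric.eventually_nhds_iff_ball.1 h.1.eventually_analyticAt
  have hd : ∀ r : ℝ, r < r₀ → DiffContOnCl ℂ (fun t => t ^ N * f t) (Metric.ball 0 r) := by
    intro r hr
    refine DifferentiableOn.diffContOnCl_ball (U := Metric.ball 0 r₀) (fun t ht =>
      (hball t ht).differentiableAt.differentiableWithinAt) ?_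
    exact Metric.closedBall_subset_ball hr
  refine Tendsto.limUnder_eq (tendsto_const_nhds.congr' ?_)
  filter_upwards [Ioo_mem_nhdsGT hr₀] with r hr
  have hcongr : ∀ n : ℤ, (∮ t in C(0, r), f t * t ^ n) =
      ∮ t in C(0, r), t ^ (n - N) * (t ^ N * f t) := by
    intro n
    refine circleIntegral.integral_congr hr.1.le fun t ht => ?_
    have ht0 : t ≠ 0 := by
      rintro rfl
      simp at ht
      linarith [hr.1]
    rw [zpow_sub₀ ht0, zpow_natCast]
    field_simp
  rw [hcongr]
  split_ifs with hm
  · have h1 := ((by fun_prop : Differentiable ℂ fun t : ℂ =>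
      t ^ (-m - 1 - N).toNat).diffContOnCl.smul (hd r hr.2)).circleIntegral_eq_zero hr.1.le
    have h2 : (∮ t in C(0, r), t ^ (-m - 1 - N : ℤ) * (t ^ N * f t)) = 0 := by
      rw [← h1]
      congr 1
      funext t
      rw [smul_eq_mul, ← zpow_natCast t (-m - 1 - N : ℤ).toNat, Int.toNat_of_nonneg (by omega)]
    rw [h2, mul_zero]
  · have h1 := (hd r hr.2).circleIntegral_one_div_sub_center_pow_smul hr.1 (m + N).natAbs
    rw [h.2, smul_eq_mul] at h1
    have h2 : ((m + N).natAbs.factorial : ℂ) ≠ 0 := by exact_mod_cast Nat.factorial_ne_zero _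
    have h3 : (∮ t in C(0, r), t ^ (-m - 1 - N : ℤ) * (t ^ N * f t)) =
        ∮ t in C(0, r), (1 / (t - 0) ^ ((m + N).natAbs + 1)) • (t ^ N * f t) := by
      congr 1
      funext t
      rw [smul_eq_mul, sub_zero, one_div, ← zpow_natCast t ((m + N).natAbs + 1), ← zpow_neg,
        show -(((m + N).natAbs + 1 : ℕ) : ℤ) = -m - 1 - N by omega]
    rw [h3, h1]
    have := two_pi_I_ne_zero
    field_simp

/-! ### The residue of `e^{2πit} (e^{2πit} - 1)^k` -/

namespace ConformalVertexAlgebra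

/-- The Taylor series of `e^{2πit}` at `t = 0`. -/
noncomputable def expPowerSeries : PowerSeries ℂ :=
  PowerSeries.rescale (2 * Real.pi * I) (PowerSeries.exp ℂ)

theorem coe_expPowerSeries : (expPowerSeries : LaurentSeries ℂ) = expSeries := rfl

theorem constantCoeff_expPowerSeries : PowerSeries.constantCoeff expPowerSeries = 1 := by
  rw [expPowerSeries, ← PowerSeries.coeff_zero_eq_constantCoeff_apply, PowerSeries.coeff_rescale]
  simp

theorem derivative_expPowerSeries : PowerSeries.derivative ℂ expPowerSeries =
    (2 * Real.pi * I : ℂ) • expPowerSeries := by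
  ext n
  rw [PowerSeries.coeff_derivative, expPowerSeries, PowerSeries.coeff_rescale,
    PowerSeries.coeff_smul, PowerSeries.coeff_rescale, PowerSeries.coeff_exp,
    PowerSeries.coeff_exp, Nat.factorial_succ]
  have h1 : (n.factorial : ℂ) ≠ 0 := by exact_mod_cast n.factorial_ne_zero
  have h2 : (n + 1 : ℂ) ≠ 0 := by exact_mod_cast n.succ_ne_zero
  simp
  field_simp
  ring

/-- The series `e^{2πit} - 1` is `t` times a unit. -/
theorem exists_expPowerSeries_sub_one_eq : ∃ u : PowerSeries ℂ,
    expPowerSeries - 1 = PowerSeries.X * u ∧ PowerSeries.constantCoeff u = 2 * Real.pi * I := by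
  obtain ⟨u, hu⟩ := (PowerSeries.X_dvd_iff (φ := expPowerSeries - 1)).2 (by
    rw [map_sub, constantCoeff_expPowerSeries, map_one, sub_self])
  refine ⟨u, hu, ?_⟩
  have h := congrArg (PowerSeries.derivative ℂ) hu
  rw [map_sub, derivative_expPowerSeries, PowerSeries.derivative_one, sub_zero, Derivation.leibniz,
    PowerSeries.derivative_X] at h
  have h2 := congrArg PowerSeries.constantCoeff h
  simpa [PowerSeries.smul_eq_C_mul, constantCoeff_expPowerSeries] using h2.symm

theorem expSeries_sub_one_ne_zero : expSeries - 1 ≠ 0 := by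
  obtain ⟨u, hu, hu0⟩ := exists_expPowerSeries_sub_one_eq
  intro h
  rw [← coe_expPowerSeries, ← PowerSeries.coe_one, ← PowerSeries.coe_sub] at h
  have h1 : expPowerSeries - 1 = 0 := by
    apply HahnSeries.ofPowerSeries_injective (Γ := ℤ)
    rw [h, map_zero]
  rw [hu, mul_eq_zero] at h1
  rcases h1 with h1 | h1
  · exact PowerSeries.X_ne_zero h1
  · rw [h1, map_zero] at hu0
    exact two_pi_I_ne_zero hu0.symm

/-- Negative powers of `e^{2πit} - 1`, with the power of `t` split off. -/
theorem exists_expSeries_sub_one_zpow {u : PowerSeries ℂ}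
    (hu : expPowerSeries - 1 = PowerSeries.X * u)
    (hu0 : PowerSeries.constantCoeff u = 2 * Real.pi * I) (K : ℕ) :
    (expSeries - 1) ^ (-K : ℤ) =
      HahnSeries.single (-K : ℤ) (1 : ℂ) * ((u⁻¹ ^ K : PowerSeries ℂ) : LaurentSeries ℂ) := by
  have hu' : u * u⁻¹ = 1 := PowerSeries.mul_inv_cancel _ (by rw [hu0]; exact two_pi_I_ne_zero)
  rw [zpow_neg, zpow_natCast]
  refine inv_eq_of_mul_eq_one_right ?_
  have h : expSeries - 1 = HahnSeries.single (1 : ℤ) (1 : ℂ) * (u : LaurentSeries ℂ) := by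
    rw [← coe_expPowerSeries, ← PowerSeries.coe_one, ← PowerSeries.coe_sub, hu,
      PowerSeries.coe_mul, PowerSeries.coe_X]
  rw [h, mul_pow, HahnSeries.single_pow, mul_mul_mul_comm, HahnSeries.single_mul_single,
    ← map_pow, ← PowerSeries.coe_mul, ← mul_pow, hu']
  simp

/-- The coefficient of `t^(-1)` in `e^{2πit} (e^{2πit} - 1)^k`, which is the derivative of
`(e^{2πit} - 1)^(k+1) / (2πi (k+1))` unless `k = -1`. -/
theorem coeff_expSeries_mul_zpow (k : ℤ) :
    (expSeries * (expSeries - 1) ^ k).coeff (-1) =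
      if k = -1 then (2 * Real.pi * I : ℂ)⁻¹ else 0 := by
  obtain ⟨u, hu, hu0⟩ := exists_expPowerSeries_sub_one_eq
  obtain ⟨n, rfl | rfl⟩ := k.eq_nat_or_neg
  · rw [if_neg (by omega), zpow_natCast, ← coe_expPowerSeries, ← PowerSeries.coe_one,
      ← PowerSeries.coe_sub, ← map_pow, ← PowerSeries.coe_mul, PowerSeries.coeff_coe,
      if_pos (by norm_num)]
  rw [exists_expSeries_sub_one_zpow hu hu0, mul_left_comm, HahnSeries.coeff_single_mul, one_mul,
    ← coe_expPowerSeries, ← PowerSeries.coe_mul, PowerSeries.coeff_coe]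
  rcases n with _ | n
  · simp
  rw [if_neg (by push_cast; omega), show (-1 - -((n + 1 : ℕ) : ℤ)).natAbs = n by omega]
  have h2 : (2 * Real.pi * I : ℂ) ≠ 0 := two_pi_I_ne_zero
  have hd := congrArg (PowerSeries.derivative ℂ) hu
  rw [map_sub, derivative_expPowerSeries, PowerSeries.derivative_one, sub_zero, Derivation.leibniz,
    PowerSeries.derivative_X, smul_eq_mul, smul_eq_mul, mul_one] at hd
  have huu : u * u⁻¹ = 1 := PowerSeries.mul_inv_cancel _ (by rw [hu0]; exact h2)
  rcases n with _ | n
  · rw [if_pos (by simp), zero_add, pow_one, PowerSeries.coeff_zero_eq_constantCoeff_apply,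
      map_mul, constantCoeff_expPowerSeries, PowerSeries.constantCoeff_inv, hu0, one_mul]
  · rw [if_neg (by push_cast; omega)]
    -- `e^{2πit} u^(-n-2)` is, up to a constant, `w - t w' / (n + 1)` with `w = u^(-n-1)`
    have hw : PowerSeries.derivative ℂ (u⁻¹ ^ (n + 1)) =
        -((n + 1 : ℕ) : PowerSeries ℂ) * (u⁻¹ ^ (n + 1 + 1) * PowerSeries.derivative ℂ u) := by
      rw [PowerSeries.derivative_pow, PowerSeries.derivative_inv']
      simp only [Nat.add_sub_cancel]
      ring
    have h3 : ((n + 1 : ℕ) : ℂ) • ((2 * Real.pi * I : ℂ) • (expPowerSeries * u⁻¹ ^ (n + 1 + 1))) =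
        ((n + 1 : ℕ) : ℂ) • u⁻¹ ^ (n + 1) -
          PowerSeries.X * PowerSeries.derivative ℂ (u⁻¹ ^ (n + 1)) := by
      rw [← smul_mul_assoc, hd, hw]
      simp only [PowerSeries.smul_eq_C_mul, map_natCast]
      linear_combination ((n + 1 : ℕ) : PowerSeries ℂ) * u⁻¹ ^ (n + 1) * huu
    have h4 := congrArg (PowerSeries.coeff (n + 1)) h3
    rw [map_sub, PowerSeries.coeff_succ_X_mul, PowerSeries.coeff_derivative,
      PowerSeries.coeff_smul, PowerSeries.coeff_smul, PowerSeries.coeff_smul] at h4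
    have h5 : ((n + 1 : ℕ) : ℂ) ≠ 0 := by exact_mod_cast n.succ_ne_zero
    have h6 : ((n + 1 : ℕ) : ℂ) * ((2 * Real.pi * I : ℂ) *
        PowerSeries.coeff (n + 1) (expPowerSeries * u⁻¹ ^ (n + 1 + 1))) = 0 := by
      simp only [smul_eq_mul] at h4
      rw [h4]; push_cast; ring
    simpa [h2] using (mul_eq_zero.1 h6).resolve_left h5

end ConformalVertexAlgebra

/-! ### The product `a_[f] b` -/

/-- The coefficients of a product of Laurent series as sums over an interval of exponents. -/
theorem coeff_mul_eq_sum_Ico {x y : LaurentSeries ℂ} {A B l : ℤ}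
    (hx : ∀ m < A, x.coeff m = 0) (hy : ∀ m < l - B + 1, y.coeff m = 0) :
    (x * y).coeff l = ∑ m ∈ Finset.Ico A B, x.coeff m * y.coeff (l - m) := by
  rw [HahnSeries.coeff_mul]
  refine Finset.sum_of_injOn Prod.fst ?_ ?_ ?_ ?_
  · intro i hi j hj hij
    simp only [Finset.mem_coe, Finset.mem_antidiagonal] at hi hj
    ext <;> omega
  · intro i hi
    simp only [Finset.mem_coe, Finset.mem_antidiagonal, HahnSeries.mem_support] at hi
    simp only [Finset.coe_Ico, Set.mem_Ico]
    by_contra hcon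
    rw [not_and_or, not_le, not_lt] at hcon
    rcases hcon with h | h
    · exact hi.1 (hx _ h)
    · exact hi.2.1 (hy _ (by omega))
  · intro m _ hm
    by_contra hne
    refine hm ⟨(m, l - m), ?_, rfl⟩
    simp only [Finset.mem_coe, Finset.mem_antidiagonal, HahnSeries.mem_support]
    exact ⟨left_ne_zero_of_mul hne, right_ne_zero_of_mul hne, by ring⟩
  · intro i hi
    simp only [Finset.mem_antidiagonal] at hi
    rw [show l - i.1 = i.2 by omega]

namespace ConformalVertexAlgebra

theorem coeff_expSeries_pow_mul_zpow_eq_zero (d : ℕ) {k l : ℤ} (h : l < k) :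
    (expSeries ^ d * (expSeries - 1) ^ k).coeff l = 0 := by
  obtain ⟨u, hu, hu0⟩ := exists_expPowerSeries_sub_one_eq
  obtain ⟨w, hw⟩ : ∃ w : PowerSeries ℂ, (expSeries - 1) ^ k =
      HahnSeries.single k (1 : ℂ) * (w : LaurentSeries ℂ) := by
    obtain ⟨n, rfl | rfl⟩ := k.eq_nat_or_neg
    · refine ⟨u ^ n, ?_⟩
      rw [zpow_natCast, ← coe_expPowerSeries, ← PowerSeries.coe_one, ← PowerSeries.coe_sub, hu,
        PowerSeries.coe_mul, PowerSeries.coe_X, mul_pow, HahnSeries.single_pow,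
        map_pow (HahnSeries.ofPowerSeries ℤ ℂ)]
      simp
    · exact ⟨_, exists_expSeries_sub_one_zpow hu hu0 n⟩
  rw [hw, mul_left_comm, HahnSeries.coeff_single_mul, one_mul, ← coe_expPowerSeries, ← map_pow,
    ← PowerSeries.coe_mul, PowerSeries.coeff_coe, if_pos (by omega)]

variable {V : Type*} [AddCommGroup V] [Module ℂ V] (𝓥 : ConformalVertexAlgebra V)

/-- The coefficient of `t^(-m-1)` in `e^{2πidt} Y(a, e^{2πit} - 1) b`. It is the mode `a_[m] b` if `a`
has weight `d`. -/
noncomputable def zhuModeOfWeight (d : ℕ) (a : V) (m : ℤ) (b : V) : V :=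
  ∑ᶠ n : ℤ, HahnSeries.coeff (expSeries ^ d * (expSeries - 1) ^ (-n - 1)) (-m - 1) •
      ncoeff (𝓥.Y a) n b

theorem zhuMode_eq_sum (a : V) (m : ℤ) (b : V) : 𝓥.zhuMode a m b =
    ∑ d ∈ 𝓥.weights a, 𝓥.zhuModeOfWeight d (𝓥.component d a) m b := rfl

variable {𝓥} {a b : V} {M : ℕ}

theorem zhuModeOfWeight_eq_sum (hM : ∀ j : ℤ, M ≤ j → ncoeff (𝓥.Y a) j b = 0) (d : ℕ)
    {A m : ℤ} (hm : A ≤ m) : 𝓥.zhuModeOfWeight d a m b = ∑ n ∈ Finset.Ico A M,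
      HahnSeries.coeff (expSeries ^ d * (expSeries - 1) ^ (-n - 1)) (-m - 1) •
        ncoeff (𝓥.Y a) n b := by
  refine finsum_eq_finsetSum_of_support_subset _ fun n hn => ?_
  rw [Finset.coe_Ico, Set.mem_Ico]
  by_contra hcon
  rw [not_and_or, not_le, not_lt] at hcon
  refine hn ?_
  rcases hcon with h | h
  · simp only []
    rw [coeff_expSeries_pow_mul_zpow_eq_zero d (by omega), zero_smul]
  · simp only []
    rw [hM n h, smul_zero]

theorem zhuModeOfWeight_eq_zero (hM : ∀ j : ℤ, M ≤ j → ncoeff (𝓥.Y a) j b = 0) (d : ℕ)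
    {m : ℤ} (hm : M ≤ m) : 𝓥.zhuModeOfWeight d a m b = 0 := by
  rw [zhuModeOfWeight_eq_sum hM d hm, Finset.Ico_self, Finset.sum_empty]

variable {f : ℂ → ℂ} {N : ℕ} {p : PowerSeries ℂ}

theorem support_laurentCoeff_smul_subset (hp : HasTaylorSeries (fun t => t ^ N * f t) p)
    (hM : ∀ j : ℤ, M ≤ j → ncoeff (𝓥.Y a) j b = 0) (d : ℕ) :
    (Function.support fun m : ℤ => laurentCoeff f m • 𝓥.zhuModeOfWeight d a m b) ⊆
      Finset.Ico (-N : ℤ) M := by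
  intro m hm
  rw [Finset.coe_Ico, Set.mem_Ico]
  by_contra hcon
  rw [not_and_or, not_le, not_lt] at hcon
  refine hm ?_
  rcases hcon with h | h
  · simp only []
    rw [laurentCoeff_eq_coeff hp, HahnSeries.coeff_single_mul, one_mul, PowerSeries.coeff_coe,
      if_pos (by omega), zero_smul]
  · simp only []
    rw [zhuModeOfWeight_eq_zero hM d h, smul_zero]

/-- The substitution `z = e^{2πit}` in the residue that defines the product `a_[f] b`. The hypothesis on
`g` says that `z^(d-1) (z-1)^N f = ∑ i, c i * (z - 1)^i + (z - 1)^(N+M) g`, in terms of Taylor series in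
`t`. -/
theorem finsum_laurentCoeff_smul_zhuModeOfWeight
    (hp : HasTaylorSeries (fun t => t ^ N * f t) p)
    (hM : ∀ j : ℤ, M ≤ j → ncoeff (𝓥.Y a) j b = 0) (d : ℕ) {c : ℕ → ℂ} {g : PowerSeries ℂ}
    (hg : expPowerSeries ^ d * (expPowerSeries - 1) ^ N * p =
      PowerSeries.X ^ N * (expPowerSeries * (∑ i ∈ Finset.range (N + M),
        PowerSeries.C (c i) * (expPowerSeries - 1) ^ i + (expPowerSeries - 1) ^ (N + M) * g))) :
    ∑ᶠ m : ℤ, laurentCoeff f m • 𝓥.zhuModeOfWeight d a m b =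
      ∑ i ∈ Finset.range (N + M),
        ((2 * Real.pi * I : ℂ)⁻¹ * c i) • ncoeff (𝓥.Y a) ((i : ℤ) - N) b := by
  have hP := expSeries_sub_one_ne_zero
  set L : LaurentSeries ℂ := HahnSeries.single (-N : ℤ) (1 : ℂ) * (p : LaurentSeries ℂ) with hL
  have hL' : expSeries ^ d * (expSeries - 1) ^ N * L = expSeries * (∑ i ∈ Finset.range (N + M),
      HahnSeries.C (c i) * (expSeries - 1) ^ i + (expSeries - 1) ^ (N + M) *
        (g : LaurentSeries ℂ)) := by
    have h := congrArg (HahnSeries.ofPowerSeries ℤ ℂ) hg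
    simp only [map_mul, map_pow, map_sub, map_one, map_add, map_sum, coe_expPowerSeries,
      HahnSeries.ofPowerSeries_C, HahnSeries.ofPowerSeries_X] at h
    rw [hL, mul_left_comm, h, ← mul_assoc, HahnSeries.single_pow, HahnSeries.single_mul_single]
    simp
  -- the residue for a single mode
  have hres : ∀ n : ℤ, n < M → (L * (expSeries ^ d * (expSeries - 1) ^ (-n - 1))).coeff (-1) =
      ∑ i ∈ Finset.range (N + M), c i * if (i : ℤ) - N = n then (2 * Real.pi * I : ℂ)⁻¹ else 0 := by
    intro n hn
    have h1 : L * (expSeries ^ d * (expSeries - 1) ^ (-n - 1)) = ∑ i ∈ Finset.range (N + M),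
        HahnSeries.C (c i) * (expSeries * (expSeries - 1) ^ ((i : ℤ) - N - n - 1)) +
          expSeries * (expSeries - 1) ^ (M - n - 1 : ℤ).toNat * (g : LaurentSeries ℂ) := by
      have h2 : L * (expSeries ^ d * (expSeries - 1) ^ (-n - 1)) =
          (expSeries ^ d * (expSeries - 1) ^ N * L) * (expSeries - 1) ^ (-(N : ℤ) - n - 1) := by
        rw [show -(N : ℤ) - n - 1 = -n - 1 - N by ring, zpow_sub₀ hP (-n - 1), zpow_natCast]
        field_simp
      rw [h2, hL', mul_add, add_mul, Finset.mul_sum, Finset.sum_mul]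
      congr 1
      · refine Finset.sum_congr rfl fun i _ => ?_
        rw [show (i : ℤ) - N - n - 1 = i + (-(N : ℤ) - n - 1) by ring, zpow_add₀ hP, zpow_natCast]
        ring
      · rw [← zpow_natCast _ (M - n - 1 : ℤ).toNat, Int.toNat_of_nonneg (by omega),
          show (M : ℤ) - n - 1 = ((N + M : ℕ) : ℤ) + (-(N : ℤ) - n - 1) by push_cast; ring,
          zpow_add₀ hP, zpow_natCast]
        ring
    rw [h1, HahnSeries.coeff_add, HahnSeries.coeff_sum]
    have h3 : (expSeries * (expSeries - 1) ^ (M - n - 1 : ℤ).toNat *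
        (g : LaurentSeries ℂ)).coeff (-1) = 0 := by
      rw [← coe_expPowerSeries, ← PowerSeries.coe_one, ← PowerSeries.coe_sub, ← map_pow,
        ← PowerSeries.coe_mul, ← PowerSeries.coe_mul, PowerSeries.coeff_coe, if_pos (by norm_num)]
    rw [h3, add_zero]
    refine Finset.sum_congr rfl fun i _ => ?_
    rw [HahnSeries.C_mul_eq_smul, HahnSeries.coeff_smul, coeff_expSeries_mul_zpow, smul_eq_mul]
    congr 1
    exact if_congr (by constructor <;> intro h <;> omega) rfl rfl
  rw [finsum_eq_finsetSum_of_support_subset _ (support_laurentCoeff_smul_subset hp hM d)]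
  have h4 : ∀ m ∈ Finset.Ico (-N : ℤ) M, laurentCoeff f m • 𝓥.zhuModeOfWeight d a m b =
      ∑ n ∈ Finset.Ico (-N : ℤ) M, (L.coeff m *
        (expSeries ^ d * (expSeries - 1) ^ (-n - 1)).coeff (-1 - m)) • ncoeff (𝓥.Y a) n b := by
    intro m hm
    rw [zhuModeOfWeight_eq_sum hM d (Finset.mem_Ico.1 hm).1, laurentCoeff_eq_coeff hp,
      Finset.smul_sum]
    refine Finset.sum_congr rfl fun n _ => ?_
    rw [smul_smul, show -m - 1 = -1 - m by ring]
  rw [Finset.sum_congr rfl h4, Finset.sum_comm]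
  have h5 : ∀ n ∈ Finset.Ico (-N : ℤ) M, ∑ m ∈ Finset.Ico (-N : ℤ) M, (L.coeff m *
        (expSeries ^ d * (expSeries - 1) ^ (-n - 1)).coeff (-1 - m)) • ncoeff (𝓥.Y a) n b =
      ∑ i ∈ Finset.range (N + M), if (i : ℤ) - N = n then
        ((2 * Real.pi * I : ℂ)⁻¹ * c i) • ncoeff (𝓥.Y a) ((i : ℤ) - N) b else 0 := by
    intro n hn
    rw [Finset.mem_Ico] at hn
    rw [← Finset.sum_smul, ← coeff_mul_eq_sum_Ico, hres n hn.2, Finset.sum_smul]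
    · refine Finset.sum_congr rfl fun i _ => ?_
      split_ifs with h
      · rw [h, mul_comm]
      · rw [mul_zero, zero_smul]
    · intro m hm
      rw [hL, HahnSeries.coeff_single_mul, one_mul, PowerSeries.coeff_coe, if_pos (by omega)]
    · intro m hm
      exact coeff_expSeries_pow_mul_zpow_eq_zero d (by omega)
  rw [Finset.sum_congr rfl h5, Finset.sum_comm]
  refine Finset.sum_congr rfl fun i hi => ?_
  rw [Finset.sum_ite_eq, if_pos]
  rw [Finset.mem_range] at hi
  rw [Finset.mem_Ico]
  omega

end ConformalVertexAlgebra

namespace ConformalVertexAlgebra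

variable {V : Type*} [AddCommGroup V] [Module ℂ V] (𝓥 : ConformalVertexAlgebra V)

/-- A bound for the order of the poles of `Y(a_d, z) b_e` for all components of `a` and `b`. -/
theorem exists_component_mode_eq_zero (a b : V) : ∃ M : ℕ, ∀ d e : ℕ, ∀ j : ℤ, M ≤ j →
    ncoeff (𝓥.Y (𝓥.component d a)) j (𝓥.component e b) = 0 := by
  choose m hm using fun d e => 𝓥.exists_mode_eq_zero (𝓥.component d a) (𝓥.component e b)
  refine ⟨(𝓥.weights a).sup fun d => (𝓥.weights b).sup fun e => m d e, fun d e j hj => ?_⟩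
  by_cases hd : d ∈ 𝓥.weights a
  · by_cases he : e ∈ 𝓥.weights b
    · refine hm d e j (le_trans ?_ hj)
      have h1 := Finset.le_sup (f := fun e => m d e) he
      have h2 := Finset.le_sup (f := fun d => (𝓥.weights b).sup fun e => m d e) hd
      exact_mod_cast h1.trans h2
    · rw [𝓥.component_eq_zero he, map_zero]
  · rw [𝓥.component_eq_zero hd]
    simp

variable {𝓥}

/-- The product `a_[f] b` in terms of the expansions of `z^(d-1) (z-1)^N f`, `d` a weight of `a`,
at `z = 1`. -/
theorem zhuProd_eq_sum {f k : ℂ → ℂ} {N : ℕ} (hf : AnalyticAt ℂ (fun t => t ^ N * f t) 0)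
    (hfk : ∀ᶠ t in 𝓝 (0 : ℂ),
      (exp (2 * Real.pi * I * t) - 1) ^ N * f t = k (exp (2 * Real.pi * I * t)))
    {a b : V} {M : ℕ} (hM : ∀ d : ℕ, ∀ j : ℤ, M ≤ j → ncoeff (𝓥.Y (𝓥.component d a)) j b = 0)
    {c : ℕ → ℕ → ℂ} {G : ℕ → ℂ → ℂ} (hG : ∀ d, AnalyticAt ℂ (G d) 1)
    (hc : ∀ d : ℕ, ∀ z, z ^ ((d : ℤ) - 1) * k z = ∑ i ∈ Finset.range (N + M), c d i * (z - 1) ^ i +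
        (z - 1) ^ (N + M) * G d z) :
    𝓥.zhuProd f a b = ∑ d ∈ 𝓥.weights a, ∑ i ∈ Finset.range (N + M),
      ((2 * Real.pi * I : ℂ)⁻¹ * c d i) • ncoeff (𝓥.Y (𝓥.component d a)) ((i : ℤ) - N) b := by
  obtain ⟨p, hp⟩ := hf.exists_hasTaylorSeries
  have hE : HasTaylorSeries (fun t => exp (2 * Real.pi * I * t)) expPowerSeries :=
    HasTaylorSeries.exp_mul _
  have hE1 : HasTaylorSeries (fun t => exp (2 * Real.pi * I * t) - 1) (expPowerSeries - 1) := by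
    simpa [sub_eq_add_neg] using hE.add (HasTaylorSeries.const (-1))
  rw [zhuProd]
  simp only [zhuMode_eq_sum, Finset.smul_sum]
  rw [finsum_sum_comm _ _ fun d _ =>
    (Finset.finite_toSet _).subset (support_laurentCoeff_smul_subset hp (hM d) d)]
  refine Finset.sum_congr rfl fun d _ => ?_
  have hGd : AnalyticAt ℂ (fun t => G d (exp (2 * Real.pi * I * t))) 0 :=
    AnalyticAt.comp (g := G d) (f := fun t : ℂ => exp (2 * Real.pi * I * t))
      (by simpa using hG d) (by fun_prop)
  obtain ⟨g, hg⟩ := hGd.exists_hasTaylorSeries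
  refine finsum_laurentCoeff_smul_zhuModeOfWeight hp (hM d) d (c := c d) (g := g) ?_
  refine (((hE.pow d).mul (hE1.pow N)).mul hp).eq
    ((HasTaylorSeries.id.pow N).mul (hE.mul ((HasTaylorSeries.sum fun i _ =>
      (HasTaylorSeries.const (c d i)).mul (hE1.pow i)).add ((hE1.pow (N + M)).mul hg)))) ?_
  filter_upwards [hfk] with t ht
  rw [← hc d, ← ht, zpow_sub_one₀ (exp_ne_zero _), zpow_natCast]
  have := exp_ne_zero (2 * Real.pi * I * t)
  field_simp

variable (𝓥)

/-- If `F_±`, shifted by `d - 1`, are the expansions of `∑ i, c d i * (z - 1) ^ (i - N)` up to the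
same remainder `ρ d`, for all weights `d`, then the residues of `F_-(z/w) X(a,z) X(b,w)` and
`F_+(z/w) X(b,w) X(a,z)` exist, and their difference does not involve the remainders. -/
theorem exists_isResidueOfProd_X (a b : V) {M N L : ℕ}
    (hM : ∀ d e : ℕ, ∀ j : ℤ, M ≤ j →
      ncoeff (𝓥.Y (𝓥.component d a)) j (𝓥.component e b) = 0)
    {c : ℕ → ℕ → ℂ} {ρ : ℕ → ℤ → ℂ}
    (hρ : ∀ d j : ℕ, j < M → HasSum (fun x : ℤ => ρ d x * ((Ring.choose x j : ℤ) : ℂ)) 0)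
    {Fp Fm : ℤ → ℂ}
    (hFp : ∀ (d : ℕ) (n : ℤ), Fp n = ∑ i ∈ Finset.range L,
      c d i * binomAtZero (i - N) (n + ((d : ℤ) - 1)) + ρ d (n + ((d : ℤ) - 1)))
    (hFm : ∀ (d : ℕ) (n : ℤ), Fm n = ∑ i ∈ Finset.range L,
      c d i * binomAtInfty (i - N) (n + ((d : ℤ) - 1)) + ρ d (n + ((d : ℤ) - 1))) :
    ∃ A B : VertexOperator ℂ V,
      IsResidueOfProd Fm (fun m l => ncoeff (𝓥.X a) m * ncoeff (𝓥.X b) l) A ∧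
      IsResidueOfProd Fp (fun m l => ncoeff (𝓥.X b) l * ncoeff (𝓥.X a) m) B ∧
      ∀ (l : ℤ) (v : V), ncoeff A l v - ncoeff B l v =
        ∑ d ∈ 𝓥.weights a, ∑ i ∈ Finset.range L, c d i •
          ncoeff (𝓥.X (ncoeff (𝓥.Y (𝓥.component d a)) ((i : ℤ) - N) b)) l v := by
  -- the residues for homogeneous components
  have hhom : ∀ (v : V) (l : ℤ) (d e : ℕ), ∃ s s' : V,
      HasFinDimSum (fun n : ℤ => Fm n • ncoeff (𝓥.Y (𝓥.component d a)) (n + d - 1)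
        (ncoeff (𝓥.Y (𝓥.component e b)) (l - n + e - 1) v)) s ∧
      HasFinDimSum (fun n : ℤ => Fp n • ncoeff (𝓥.Y (𝓥.component e b)) (l - n + e - 1)
        (ncoeff (𝓥.Y (𝓥.component d a)) (n + d - 1) v)) s' ∧
      s - s' = ∑ i ∈ Finset.range L, c d i •
        ncoeff (𝓥.X (ncoeff (𝓥.Y (𝓥.component d a)) ((i : ℤ) - N) (𝓥.component e b))) l v := by
    intro v l d e
    obtain ⟨s, s', hs, hs', h⟩ := 𝓥.exists_hasFinDimSum_residues (𝓥.component d a)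
      (𝓥.component e b) v (l + d + e - 2) (hM d e) (hρ d)
      (L := L) (N := N) (c := c d)
      (Fm := fun x => Fm (x - ((d : ℤ) - 1))) (Fp := fun x => Fp (x - ((d : ℤ) - 1)))
      (fun x => by simp only [hFm d, sub_add_cancel]) (fun x => by
        simp only [hFp d, sub_add_cancel])
    refine ⟨s, s', (hs.comp_equiv (Equiv.addRight ((d : ℤ) - 1))).congr (fun n => ?_) rfl,
      (hs'.comp_equiv (Equiv.addRight ((d : ℤ) - 1))).congr (fun n => ?_) rfl, h.trans ?_⟩
    · rw [Equiv.coe_addRight, add_sub_cancel_right, add_sub_assoc,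
        show l + (d : ℤ) + e - 2 - (n + (d - 1)) = l - n + e - 1 by ring]
    · rw [Equiv.coe_addRight, add_sub_cancel_right, add_sub_assoc n,
        show l + (d : ℤ) + e - 2 - (n + (d - 1)) = l - n + e - 1 by ring]
    · refine Finset.sum_congr rfl fun i _ => ?_
      rw [((𝓥.hasWeight_component d a).mode (𝓥.hasWeight_component e b) ((i : ℤ) - N)).X_mode_eq,
        show l + (d : ℤ) + e - 2 - ((i : ℤ) - N) = l + (d + e - ((i : ℤ) - N) - 1) - 1 by ring]
  choose s s' hs hs' hss using hhom
  have hA : ∀ v l, HasFinDimSum (fun n : ℤ => Fm n • (ncoeff (𝓥.X a) n * ncoeff (𝓥.X b) (l - n)) v)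
      (∑ d ∈ 𝓥.weights a, ∑ e ∈ 𝓥.weights b, s v l d e) := fun v l =>
    (HasFinDimSum.sum fun d _ => HasFinDimSum.sum fun e _ => hs v l d e).congr (fun n => by
      simp only [Module.End.mul_apply, 𝓥.X_mode, LinearMap.sum_apply, map_sum, Finset.smul_sum]
      exact Finset.sum_comm) rfl
  have hB : ∀ v l, HasFinDimSum (fun n : ℤ => Fp n • (ncoeff (𝓥.X b) (l - n) * ncoeff (𝓥.X a) n) v)
      (∑ d ∈ 𝓥.weights a, ∑ e ∈ 𝓥.weights b, s' v l d e) := fun v l =>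
    (HasFinDimSum.sum fun d _ => HasFinDimSum.sum fun e _ => hs' v l d e).congr (fun n => by
      simp only [Module.End.mul_apply, 𝓥.X_mode, LinearMap.sum_apply, map_sum, Finset.smul_sum]) rfl
  obtain ⟨A, hA'⟩ := exists_isResidueOfProd
    (P := fun m l => ncoeff (𝓥.X a) m * ncoeff (𝓥.X b) l) (fun v l => ⟨_, hA v l⟩)
    fun v => by
      obtain ⟨K, hK⟩ := 𝓥.exists_X_mode_X_mode_eq_zero a b v
      exact ⟨K, fun l hl n => hK l hl n⟩
  obtain ⟨B, hB'⟩ := exists_isResidueOfProd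
    (P := fun m l => ncoeff (𝓥.X b) l * ncoeff (𝓥.X a) m) (fun v l => ⟨_, hB v l⟩) fun v => by
      obtain ⟨K, hK⟩ := 𝓥.exists_X_mode_X_mode_eq_zero b a v
      refine ⟨K, fun l hl n => ?_⟩
      simpa using hK l hl (l - n)
  refine ⟨A, B, hA', hB', fun l v => ?_⟩
  rw [(hA' v l).unique (hA v l), (hB' v l).unique (hB v l), ← Finset.sum_sub_distrib]
  refine Finset.sum_congr rfl fun d _ => ?_
  rw [← Finset.sum_sub_distrib, Finset.sum_congr rfl fun e _ => hss v l d e, Finset.sum_comm]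
  refine Finset.sum_congr rfl fun i _ => ?_
  rw [← Finset.smul_sum]
  congr 1
  conv_rhs => rw [← 𝓥.sum_component b]
  simp only [← XModeₗ_apply, map_sum, LinearMap.sum_apply]

end ConformalVertexAlgebra

theorem mainTheorem5 {V : Type*} [AddCommGroup V] [Module ℂ V] (𝓥 : ConformalVertexAlgebra V)
    (τ : ℂ) (hτ : 0 < τ.im) (f : ℂ → ℂ) (hf : Meromorphic f)
    (hper : ∀ᶠ t in codiscrete ℂ, f (t + 1) = f t)
    (han : ∀ t : ℂ, -τ.im < t.im → t.im < τ.im → (∀ m : ℤ, t ≠ m) → AnalyticAt ℂ f t)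
    (hcase : 0 ≤ meromorphicOrderAt f 0 ∨
      ∃ α : ℂ, ∀ᶠ t in codiscrete ℂ, f (t + τ) = f t - α) :
    ∃ Fp Fm : ℤ → ℂ,
      -- the Fourier expansions of `f` on `|q| < |z| < 1` and on `1 < |z| < |q|⁻¹`
      (∀ y : ℝ, 0 < y → y < τ.im → ∀ n, Fp n = lineFourierCoeff f y n) ∧
      (∀ y : ℝ, -τ.im < y → y < 0 → ∀ n, Fm n = lineFourierCoeff f y n) ∧
      (∀ t : ℂ, 0 < t.im → t.im < τ.im →
        HasSum (fun n : ℤ => Fp n * exp (2 * Real.pi * I * t) ^ n) (f t)) ∧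
      (∀ t : ℂ, -τ.im < t.im → t.im < 0 →
        HasSum (fun n : ℤ => Fm n * exp (2 * Real.pi * I * t) ^ n) (f t)) ∧
      ∀ a b : V, ∃ A B : VertexOperator ℂ V,
        -- `A = res_z F₋(z/w) X(a,z) X(b,w)` and `B = res_z F₊(z/w) X(b,w) X(a,z)`
        IsResidueOfProd Fm (fun m l => ncoeff (𝓥.X a) m * ncoeff (𝓥.X b) l) A ∧
        IsResidueOfProd Fp (fun m l => ncoeff (𝓥.X b) l * ncoeff (𝓥.X a) m) B ∧
        (2 * Real.pi * I : ℂ) • 𝓥.X (𝓥.zhuProd f a b) = A - B := by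
  obtain ⟨N, k, hN, hk, hfk⟩ := exists_eq_comp_exp hτ (hf 0) hper han
  -- any of the decompositions gives the Fourier series
  obtain ⟨Fp, Fm, hp₀, hm₀⟩ : ∃ Fp Fm : ℤ → ℂ,
      (∀ t : ℂ, 0 < t.im → t.im < τ.im →
        HasSum (fun n : ℤ => Fp n * exp (2 * Real.pi * I * t) ^ n) (f t)) ∧
      (∀ t : ℂ, -τ.im < t.im → t.im < 0 →
        HasSum (fun n : ℤ => Fm n * exp (2 * Real.pi * I * t) ^ n) (f t)) := by
    obtain ⟨c, ρ, -, -, -, -, hp, hm⟩ := exists_fourier_decomposition hτ hk hfk 0 0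
    exact ⟨_, _, hp, hm⟩
  have hline : ∀ {F : ℤ → ℂ} {y : ℝ}, (∀ t : ℂ, t.im = y →
      HasSum (fun n : ℤ => F n * exp (2 * Real.pi * I * t) ^ n) (f t)) →
      ∀ n, lineFourierCoeff f y n = F n := fun {F y} h n =>
    lineFourierCoeff_eq_of_hasSum (fun x => h (x + y * I) (by simp)) n
  refine ⟨Fp, Fm, fun y hy hy' n => (hline (fun t ht => hp₀ t (ht ▸ hy) (ht ▸ hy')) n).symm,
    fun y hy hy' n => (hline (fun t ht => hm₀ t (ht ▸ hy) (ht ▸ hy')) n).symm, hp₀, hm₀,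
    fun a b => ?_⟩
  obtain ⟨M, hM⟩ := 𝓥.exists_component_mode_eq_zero a b
  choose c ρ G hG hc hρ hp hm using fun d : ℕ =>
    exists_fourier_decomposition hτ hk hfk ((d : ℤ) - 1) M
  -- by uniqueness of Fourier coefficients, all decompositions give the same coefficients
  have hFp' : ∀ (d : ℕ) (n : ℤ), Fp n = ∑ i ∈ Finset.range (N + M),
      c d i * binomAtZero (i - N) (n + ((d : ℤ) - 1)) + ρ d (n + ((d : ℤ) - 1)) := fun d n => by
    rw [← hline (y := τ.im / 2) (fun t ht => hp₀ t (by linarith) (by linarith)) n,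
      hline (y := τ.im / 2) (fun t ht => hp d t (by linarith) (by linarith)) n]
  have hFm' : ∀ (d : ℕ) (n : ℤ), Fm n = ∑ i ∈ Finset.range (N + M),
      c d i * binomAtInfty (i - N) (n + ((d : ℤ) - 1)) + ρ d (n + ((d : ℤ) - 1)) := fun d n => by
    rw [← hline (y := -(τ.im / 2)) (fun t ht => hm₀ t (by linarith) (by linarith)) n,
      hline (y := -(τ.im / 2)) (fun t ht => hm d t (by linarith) (by linarith)) n]
  obtain ⟨A, B, hA, hB, hAB⟩ := 𝓥.exists_isResidueOfProd_X a b hM hρ hFp' hFm'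
  refine ⟨A, B, hA, hB, ?_⟩
  have hMb : ∀ d : ℕ, ∀ j : ℤ, M ≤ j → ncoeff (𝓥.Y (𝓥.component d a)) j b = 0 := fun d j hj => by
    rw [← 𝓥.sum_component b, map_sum]
    exact Finset.sum_eq_zero fun e _ => hM d e j hj
  have hzhu := ConformalVertexAlgebra.zhuProd_eq_sum (𝓥 := 𝓥) hN (by
    have hopen : IsOpen {t : ℂ | -τ.im < t.im ∧ t.im < τ.im} :=
      (isOpen_lt continuous_const continuous_im).inter (isOpen_lt continuous_im continuous_const)
    filter_upwards [hopen.mem_nhds (x := 0) ⟨by simpa using hτ, by simpa using hτ⟩] with t ht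
    exact hfk t ht.1 ht.2) hMb hG hc
  refine HVertexOperator.coeff_inj (funext fun y => LinearMap.ext fun v => ?_)
  rw [VertexOperator.coeff_eq_ncoeff, VertexOperator.coeff_eq_ncoeff]
  set l := -y - 1
  have h1 : ncoeff (A - B) l v = ncoeff A l v - ncoeff B l v := by rw [map_sub]; rfl
  have h2 : ncoeff ((2 * Real.pi * I : ℂ) • 𝓥.X (𝓥.zhuProd f a b)) l v =
      (2 * Real.pi * I : ℂ) • 𝓥.XModeₗ l (𝓥.zhuProd f a b) v := by rw [map_smul]; rfl
  rw [h1, hAB, h2, hzhu, map_sum, LinearMap.sum_apply, Finset.smul_sum]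
  refine Finset.sum_congr rfl fun d _ => ?_
  rw [map_sum, LinearMap.sum_apply, Finset.smul_sum]
  refine Finset.sum_congr rfl fun i _ => ?_
  rw [map_smul, LinearMap.smul_apply, smul_smul, ← mul_assoc, mul_inv_cancel₀ two_pi_I_ne_zero,
    one_mul]
  rfl
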